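/- Let $$L=\Big\{\limsup_{\substack{p,q\in\mathbb Z\\ |p|,|q|\to\infty}}\frac1{|q(q\alpha-p)|}<\infty:\ \alpha\in\mathbb R\setminus\mathbb Q\Big\}$$ be the Lagrange spectrum and $$M=\Big\{\frac1{\inf_{(x,y)\in\mathbb Z^2\setminus\{(0,0)\}}|ax^2+bxy+cy^2|}<\infty:\ a,b,c\in\mathbb R,\ b^2-4ac=1\Big\}$$ the Markov spectrum. Let $K(\{1,2\})$ be the set of all the values of the infinite continued fractions $[0;\gamma_1,\gamma_2,\dots]=\cfrac{1}{\gamma_1+\cfrac{1}{\gamma_2+\cdots}}$ with $\gamma_i\in\{1,2\}$ for all $i\ge 1$. Then there is a set $K\subset\mathbb R$ of Hausdorff dimension $HD(K)<0.174813$ such that $$(M\setminus L)\cap(\sqrt{10},\sqrt{13})\subset K(\{1,2\})+K=\{x+y:\ x\in K(\{1,2\}),\ y\in K\}.$$ -/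

import Mathlib

open Filter Topology
open scoped Pointwise

/-- The Lagrange spectrum: all finite values of `limsup 1 / |q (q α - p)|` as the integers `p` and
`q` tend to infinity (that is, `|p| → ∞` and `|q| → ∞`), for `α` irrational. The upper limit is
taken in the extended reals, so that equality with a real number says that it is finite. -/
def lagrangeSpectrum : Set ℝ :=
  {m | ∃ α : ℝ, Irrational α ∧
    limsup (fun z : ℤ × ℤ => ((1 / |(z.2 : ℝ) * ((z.2 : ℝ) * α - (z.1 : ℝ))| : ℝ) : EReal))
      ((cofinite : Filter ℤ) ×ˢ (cofinite : Filter ℤ)) = (m : EReal)}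

/-- The infimum of `|a x ^ 2 + b x y + c y ^ 2|` over the integer vectors `(x, y) ≠ (0, 0)`
(an infimum of a nonempty set of nonnegative reals). -/
noncomputable def formInf (a b c : ℝ) : ℝ :=
  sInf {v : ℝ | ∃ x y : ℤ, (x, y) ≠ (0, 0) ∧
    v = |a * (x : ℝ) ^ 2 + b * (x : ℝ) * (y : ℝ) + c * (y : ℝ) ^ 2|}

/-- The Markov spectrum: all finite values of `1 / inf |a x ^ 2 + b x y + c y ^ 2|`, for real binary
quadratic forms of discriminant `1` (which are automatically indefinite). The value is finite
exactly when the infimum is positive. -/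
def markovSpectrum : Set ℝ :=
  {m | ∃ a b c : ℝ, b ^ 2 - 4 * a * c = 1 ∧ 0 < formInf a b c ∧ m = 1 / formInf a b c}

/-- The infinite continued fraction `[0; γ 0, γ 1, γ 2, …]`. -/
noncomputable def contFracSeq (γ : ℕ → ℕ+) : GenContFract ℝ :=
  ⟨0, Stream'.Seq.ofStream fun n => ⟨1, ((γ n : ℕ) : ℝ)⟩⟩

/-- The set `K(A)` of all the values (limits of convergents) of continued fractions
`[0; γ 0, γ 1, γ 2, …]` whose partial quotients all belong to `A`. -/
def contFracCantor (A : Set ℕ+) : Set ℝ :=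
  {x | ∃ γ : ℕ → ℕ+, (∀ n, γ n ∈ A) ∧ Tendsto (contFracSeq γ).convs atTop (𝓝 x)}

/-! A Markov value m < √13 with m > 3 is the supremum, attained at index 0, of the heights of a
bi-infinite sequence `a` over {1, 2} (`exists_height_eq_of_mem_markovSpectrum`). If m > √10, then a
0 = 2 and m = [left tail] + (2 + [right tail]). Both tails have values in K({1, 2}), so it suffices
to confine one of them to a set of small dimension.

Suppose that arbitrarily far out on both sides `a` can be cut and continued by one of two fixed test
tails, each ending in 2, 2, 2, …, at arbitrarily small cost in height. Longer and longer windows of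
these modified sequences can then be concatenated, so m ∈ L (`mem_lagrangeSpectrum_of_extendable`).
Hence for m ∉ L one side is obstructed, and by reversal it may be taken to be the right one.

Take two obstructed sequences with nearly equal m that agree for a long time and then split, 2
against 1. A test tail with value between theirs would be an admissible continuation: its own
heights are below √10, and earlier heights are controlled by those of the two sequences
(`height_graft_le`). So neither test tail lies in the gap, which forces the continuations 2, 2, 1, 2
and 1, 1, 2 (`branching_of_not_extendable`). These blocks contract by (2/5)^6 and (3/5)^6, and 2/5 +
3/5 = 1, so the dimension is at most 1/6 (`Branching.dimH_le`). Countably many choices of auxiliary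
data cover all obstructed tails. -/

open scoped ENNReal NNReal

/-! ### Finite and infinite continued fractions -/

/-- The finite continued fraction `[0; γ 0, …, γ (n - 2), γ (n - 1) + t]`. -/
noncomputable def cfPre : ℕ → (ℕ → ℕ+) → ℝ → ℝ
  | 0, _, t => t
  | n + 1, γ, t => 1 / ((γ 0 : ℝ) + cfPre n (fun k => γ (k + 1)) t)

lemma one_le_pnat_cast (n : ℕ+) : (1 : ℝ) ≤ (n : ℝ) := by exact_mod_cast PNat.pos n

lemma one_div_add_mem {a t : ℝ} (ha : 1 ≤ a) (ht : t ∈ Set.Icc (0 : ℝ) 1) :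
    1 / (a + t) ∈ Set.Icc (0 : ℝ) 1 := by
  have h0 := ht.1
  refine ⟨by positivity, ?_⟩
  rw [div_le_one (by linarith)]
  linarith

lemma cfPre_mem (n : ℕ) (γ : ℕ → ℕ+) {t : ℝ} (ht : t ∈ Set.Icc (0 : ℝ) 1) :
    cfPre n γ t ∈ Set.Icc (0 : ℝ) 1 := by
  induction n generalizing γ with
  | zero => exact ht
  | succ n ih => exact one_div_add_mem (one_le_pnat_cast _) (ih _)

lemma abs_one_div_sub {a x y : ℝ} (ha : 1 ≤ a) (hx : 0 ≤ x) (hy : 0 ≤ y) :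
    |1 / (a + x) - 1 / (a + y)| = |x - y| / ((a + x) * (a + y)) := by
  have h1 : 0 < a + x := by linarith
  have h2 : 0 < a + y := by linarith
  rw [div_sub_div _ _ h1.ne' h2.ne', abs_div, abs_of_pos (mul_pos h1 h2), abs_sub_comm]
  congr 2
  ring

lemma abs_one_div_sub_le {a x y : ℝ} (ha : 1 ≤ a) (hx : 0 ≤ x) (hy : 0 ≤ y) :
    |1 / (a + x) - 1 / (a + y)| ≤ |x - y| := by
  rw [abs_one_div_sub ha hx hy]
  apply div_le_self (abs_nonneg _)
  nlinarith

/-- A single step need not contract uniformly when the digit is 1, but two steps do: each factor a(b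
+ x) + 1 is at least 2. This gives the geometric rate in `abs_cfPre_sub_le_pow`. -/
lemma abs_one_div_one_div_sub_le {a b x y : ℝ} (ha : 1 ≤ a) (hb : 1 ≤ b) (hx : 0 ≤ x)
    (hy : 0 ≤ y) :
    |1 / (a + 1 / (b + x)) - 1 / (a + 1 / (b + y))| ≤ 1 / 4 * |x - y| := by
  have h1 : 0 < b + x := by linarith
  have h2 : 0 < b + y := by linarith
  rw [abs_one_div_sub ha (by positivity) (by positivity), abs_one_div_sub hb hx hy, div_div]
  have e : (b + x) * (b + y) * ((a + 1 / (b + x)) * (a + 1 / (b + y)))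
      = (a * (b + x) + 1) * (a * (b + y) + 1) := by
    field_simp
  rw [e, div_le_iff₀ (by positivity)]
  have h3 : 2 ≤ a * (b + x) + 1 := by nlinarith
  have h4 : 2 ≤ a * (b + y) + 1 := by nlinarith
  have h5 : 4 ≤ (a * (b + x) + 1) * (a * (b + y) + 1) := by nlinarith
  nlinarith [abs_nonneg (x - y)]

lemma abs_cfPre_sub_le (n : ℕ) (γ : ℕ → ℕ+) {s t : ℝ} (hs : s ∈ Set.Icc (0 : ℝ) 1)
    (ht : t ∈ Set.Icc (0 : ℝ) 1) : |cfPre n γ s - cfPre n γ t| ≤ |s - t| := by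
  induction n generalizing γ with
  | zero => exact le_rfl
  | succ n ih =>
    exact (abs_one_div_sub_le (one_le_pnat_cast _) (cfPre_mem _ _ hs).1
      (cfPre_mem _ _ ht).1).trans (ih _)

lemma abs_cfPre_sub_le_pow (n : ℕ) (γ : ℕ → ℕ+) {s t : ℝ} (hs : s ∈ Set.Icc (0 : ℝ) 1)
    (ht : t ∈ Set.Icc (0 : ℝ) 1) : |cfPre n γ s - cfPre n γ t| ≤ 2 * (1 / 2) ^ n := by
  have h1 : ∀ n γ, |cfPre n γ s - cfPre n γ t| ≤ 1 := fun n γ =>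
    abs_le.2 ⟨by linarith [(cfPre_mem n γ hs).1, (cfPre_mem n γ ht).2],
      by linarith [(cfPre_mem n γ hs).2, (cfPre_mem n γ ht).1]⟩
  induction n using Nat.twoStepInduction generalizing γ with
  | zero => have := h1 0 γ; norm_num at this ⊢; linarith
  | one => have := h1 1 γ; norm_num at this ⊢; linarith
  | more n ih _ =>
    refine (abs_one_div_one_div_sub_le (one_le_pnat_cast _) (one_le_pnat_cast _)
      (cfPre_mem _ _ hs).1 (cfPre_mem _ _ ht).1).trans ?_
    have := ih (fun k => γ (k + 1 + 1))
    calc _ ≤ 1 / 4 * (2 * (1 / 2 : ℝ) ^ n) := by gcongr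
      _ = _ := by ring

lemma cfPre_succ_last (n : ℕ) (γ : ℕ → ℕ+) (t : ℝ) :
    cfPre (n + 1) γ t = cfPre n γ (1 / ((γ n : ℝ) + t)) := by
  induction n generalizing γ with
  | zero => rfl
  | succ n ih =>
    rw [cfPre, ih, cfPre]

lemma cfPre_congr (n : ℕ) {γ γ' : ℕ → ℕ+} (h : ∀ k < n, γ k = γ' k) (t : ℝ) :
    cfPre n γ t = cfPre n γ' t := by
  induction n generalizing γ γ' with
  | zero => rfl
  | succ n ih =>
    rw [cfPre, cfPre, h 0 (by omega), ih (fun k hk => h (k + 1) (by omega))]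

/-- The value of the infinite continued fraction `[0; γ 0, γ 1, …]`. -/
noncomputable def cf (γ : ℕ → ℕ+) : ℝ := limUnder atTop (fun n => cfPre n γ 0)

lemma zero_mem_unit : (0 : ℝ) ∈ Set.Icc (0 : ℝ) 1 := ⟨le_rfl, zero_le_one⟩

lemma tendsto_cf (γ : ℕ → ℕ+) : Tendsto (fun n => cfPre n γ 0) atTop (𝓝 (cf γ)) := by
  apply CauchySeq.tendsto_limUnder
  apply cauchySeq_of_le_geometric (1 / 2) 2 (by norm_num)
  intro n
  rw [cfPre_succ_last, Real.dist_eq]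
  exact abs_cfPre_sub_le_pow n γ zero_mem_unit
    (one_div_add_mem (one_le_pnat_cast _) zero_mem_unit)

lemma cf_mem (γ : ℕ → ℕ+) : cf γ ∈ Set.Icc (0 : ℝ) 1 :=
  isClosed_Icc.mem_of_tendsto (tendsto_cf γ)
    (Eventually.of_forall fun n => cfPre_mem n γ zero_mem_unit)

lemma cf_eq (γ : ℕ → ℕ+) : cf γ = 1 / ((γ 0 : ℝ) + cf (fun k => γ (k + 1))) := by
  refine tendsto_nhds_unique ((tendsto_add_atTop_iff_nat 1).2 (tendsto_cf γ)) ?_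
  have h := tendsto_cf (fun k => γ (k + 1))
  have h0 : ((γ 0 : ℝ) + cf (fun k => γ (k + 1))) ≠ 0 := by
    have := one_le_pnat_cast (γ 0)
    have := (cf_mem (fun k => γ (k + 1))).1
    positivity
  exact (tendsto_const_nhds (x := (1 : ℝ))).div (tendsto_const_nhds.add h) h0

lemma cf_tail (n : ℕ) (γ : ℕ → ℕ+) :
    cf (fun k => γ (k + n)) = 1 / ((γ n : ℝ) + cf (fun k => γ (k + (n + 1)))) := by
  rw [cf_eq]
  simp only [Nat.zero_add, Nat.add_right_comm _ 1 n, Nat.add_assoc]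

lemma cf_pos (γ : ℕ → ℕ+) : 0 < cf γ := by
  rw [cf_eq]
  have := one_le_pnat_cast (γ 0)
  have := (cf_mem (fun k => γ (k + 1))).1
  positivity

lemma cf_lt_one (γ : ℕ → ℕ+) : cf γ < 1 := by
  have := one_le_pnat_cast (γ 0)
  have h := cf_pos (fun k => γ (k + 1))
  rw [cf_eq, div_lt_one (by positivity)]
  linarith

lemma cf_eq_cfPre (n : ℕ) (γ : ℕ → ℕ+) : cf γ = cfPre n γ (cf (fun k => γ (k + n))) := by
  induction n with
  | zero => rfl
  | succ n ih => rw [cfPre_succ_last, ← cf_tail, ← ih]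

lemma abs_cf_sub_le_tail (n : ℕ) {γ γ' : ℕ → ℕ+} (h : ∀ k < n, γ k = γ' k) :
    |cf γ - cf γ'| ≤ |cf (fun k => γ (k + n)) - cf (fun k => γ' (k + n))| := by
  rw [cf_eq_cfPre n γ, cf_eq_cfPre n γ', cfPre_congr n h]
  exact abs_cfPre_sub_le n γ' (cf_mem _) (cf_mem _)

lemma abs_cf_sub_le_pow (n : ℕ) {γ γ' : ℕ → ℕ+} (h : ∀ k < n, γ k = γ' k) :
    |cf γ - cf γ'| ≤ 2 * (1 / 2) ^ n := by
  rw [cf_eq_cfPre n γ, cf_eq_cfPre n γ', cfPre_congr n h]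
  exact abs_cfPre_sub_le_pow n γ' (cf_mem _) (cf_mem _)

lemma cfPre_of_rec {γ : ℕ → ℕ+} {u : ℕ → ℝ} (h : ∀ k, u k = 1 / ((γ k : ℝ) + u (k + 1)))
    (n : ℕ) : u 0 = cfPre n γ (u n) := by
  induction n with
  | zero => rfl
  | succ n ih => rw [cfPre_succ_last, ← h, ← ih]

lemma tendsto_two_mul_half_pow : Tendsto (fun n : ℕ => 2 * (1 / 2 : ℝ) ^ n) atTop (𝓝 0) := by
  simpa using (tendsto_pow_atTop_nhds_zero_of_lt_one (r := (1 / 2 : ℝ)) (by norm_num)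
    (by norm_num)).const_mul 2

lemma eq_cf_of_rec {γ : ℕ → ℕ+} {u : ℕ → ℝ} (h : ∀ k, u k = 1 / ((γ k : ℝ) + u (k + 1)))
    (hu : ∀ k, u k ∈ Set.Icc (0 : ℝ) 1) : u 0 = cf γ := by
  have h1 : ∀ n, |u 0 - cf γ| ≤ 2 * (1 / 2) ^ n := fun n => by
    rw [cfPre_of_rec h n, cf_eq_cfPre n γ]
    exact abs_cfPre_sub_le_pow n γ (hu n) (cf_mem _)
  have h2 := ge_of_tendsto' tendsto_two_mul_half_pow h1
  exact sub_eq_zero.1 (abs_eq_zero.1 (le_antisymm h2 (abs_nonneg _)))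

lemma one_div_add_mem_uIcc {a x y z : ℝ} (ha : 1 ≤ a) (hx : 0 ≤ x) (hz : 0 ≤ z)
    (hy : y ∈ Set.uIcc x z) : 1 / (a + y) ∈ Set.uIcc (1 / (a + x)) (1 / (a + z)) := by
  rcases Set.mem_uIcc.1 hy with h | h
  · exact Set.mem_uIcc.2 (Or.inr ⟨one_div_le_one_div_of_le (by linarith) (by linarith),
      one_div_le_one_div_of_le (by linarith) (by linarith)⟩)
  · exact Set.mem_uIcc.2 (Or.inl ⟨one_div_le_one_div_of_le (by linarith) (by linarith),
      one_div_le_one_div_of_le (by linarith) (by linarith)⟩)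

lemma cfPre_mem_uIcc (n : ℕ) (γ : ℕ → ℕ+) {x y z : ℝ} (hx : x ∈ Set.Icc (0 : ℝ) 1)
    (hz : z ∈ Set.Icc (0 : ℝ) 1) (hy : y ∈ Set.uIcc x z) :
    cfPre n γ y ∈ Set.uIcc (cfPre n γ x) (cfPre n γ z) := by
  induction n generalizing γ with
  | zero => exact hy
  | succ n ih =>
    exact one_div_add_mem_uIcc (one_le_pnat_cast _) (cfPre_mem _ _ hx).1 (cfPre_mem _ _ hz).1
      (ih _)

/-- A prefix preserves or reverses order according to the parity of its length; the maximum of both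
ends covers either case. -/
lemma cf_le_max (n : ℕ) {γ γ₁ γ₂ : ℕ → ℕ+} (h₁ : ∀ k < n, γ k = γ₁ k) (h₂ : ∀ k < n, γ k = γ₂ k)
    (hle₁ : cf (fun k => γ₁ (k + n)) ≤ cf (fun k => γ (k + n)))
    (hle₂ : cf (fun k => γ (k + n)) ≤ cf (fun k => γ₂ (k + n))) :
    cf γ ≤ max (cf γ₁) (cf γ₂) := by
  rw [cf_eq_cfPre n γ, cf_eq_cfPre n γ₁, cf_eq_cfPre n γ₂, ← cfPre_congr n h₁, ← cfPre_congr n h₂]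
  have := cfPre_mem_uIcc n γ (cf_mem (fun k => γ₁ (k + n))) (cf_mem (fun k => γ₂ (k + n)))
    (Set.mem_uIcc.2 (Or.inl ⟨hle₁, hle₂⟩))
  exact this.2

lemma continuous_cf : Continuous cf := by
  rw [continuous_iff_continuousAt]
  intro γ
  rw [ContinuousAt, Metric.tendsto_nhds]
  intro ε hε
  obtain ⟨n, hn⟩ := (tendsto_two_mul_half_pow.eventually (gt_mem_nhds hε)).exists
  have : ∀ᶠ γ' in 𝓝 γ, ∀ k ∈ Finset.range n, γ' k = γ k := by
    rw [Finset.eventually_all]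
    intro k _
    exact (continuous_apply k).continuousAt.eventually_mem ((isOpen_discrete {γ k}).mem_nhds rfl)
  filter_upwards [this] with γ' h
  rw [Real.dist_eq]
  exact (abs_cf_sub_le_pow n fun k hk => h k (Finset.mem_range.2 hk)).trans_lt hn

lemma contFracSeq_convs (γ : ℕ → ℕ+) (n : ℕ) : (contFracSeq γ).convs n = cfPre n γ 0 := by
  rw [GenContFract.convs_eq_convs']
  · have key : ∀ n (γ : ℕ → ℕ+), GenContFract.convs'Aux (Stream'.Seq.ofStream
        fun n => (⟨1, ((γ n : ℕ) : ℝ)⟩ : GenContFract.Pair ℝ)) n = cfPre n γ 0 := by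
      intro n
      induction n with
      | zero => intro γ; rfl
      | succ n ih =>
        intro γ
        have := ih (fun k => γ (k + 1))
        rw [cfPre, ← this]
        rfl
    simp [GenContFract.convs', contFracSeq, key]
  · intro gp m _ h
    simp only [contFracSeq] at h
    have : (⟨1, ((γ m : ℕ) : ℝ)⟩ : GenContFract.Pair ℝ) = gp := Option.some.inj h
    rw [← this]
    exact ⟨one_pos, by simp⟩

lemma cf_mem_contFracCantor {A : Set ℕ+} {γ : ℕ → ℕ+} (h : ∀ n, γ n ∈ A) :
    cf γ ∈ contFracCantor A := by
  refine ⟨γ, h, ?_⟩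
  exact (tendsto_congr (contFracSeq_convs γ)).2 (tendsto_cf γ)

lemma exists_cf_eq {x : ℝ} (hx : Irrational x) (h0 : 0 < x) (h1 : x < 1) : ∃ γ, cf γ = x := by
  let u : ℕ → ℝ := fun n => (fun y => Int.fract (1 / y))^[n] x
  have hu : ∀ n, u (n + 1) = Int.fract (1 / u n) := fun n => Function.iterate_succ_apply' _ _ _
  have hirr : ∀ n, Irrational (u n) ∧ 0 < u n ∧ u n < 1 := by
    intro n
    induction n with
    | zero => exact ⟨hx, h0, h1⟩
    | succ n ih =>
      have h2 : Irrational (u (n + 1)) := by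
        rw [hu, Int.fract, one_div]
        exact (ih.1.inv).sub_intCast _
      refine ⟨h2, ?_, by rw [hu]; exact Int.fract_lt_one _⟩
      exact lt_of_le_of_ne (by rw [hu]; exact Int.fract_nonneg _) h2.ne_zero.symm
  have hfl : ∀ n, 0 < ⌊1 / u n⌋ := fun n => by
    rw [Int.floor_pos, le_div_iff₀ (hirr n).2.1]
    linarith [(hirr n).2.2]
  let γ : ℕ → ℕ+ := fun n => ⟨⌊1 / u n⌋.toNat, by have := hfl n; omega⟩
  have hγ : ∀ n, ((γ n : ℕ) : ℝ) = ⌊1 / u n⌋ := fun n => by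
    have : ((⌊1 / u n⌋.toNat : ℤ) : ℝ) = ⌊1 / u n⌋ := by rw [Int.toNat_of_nonneg (hfl n).le]
    exact_mod_cast this
  refine ⟨γ, (eq_cf_of_rec (u := u) (fun k => ?_) fun k => ?_).symm⟩
  · rw [hγ, hu, Int.floor_add_fract, one_div_one_div]
  · exact ⟨(hirr k).2.1.le, (hirr k).2.2.le⟩

/-- Descent on the denominator: if the value is p/q, then p < q and the tail has value (q - γ 0
p)/p. -/
lemma irrational_cf (γ : ℕ → ℕ+) : Irrational (cf γ) := by
  have key : ∀ q : ℕ, ∀ (p : ℤ) (γ : ℕ → ℕ+), 0 < q → cf γ ≠ (p : ℝ) / q := by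
    intro q
    induction q using Nat.strong_induction_on with
    | _ q ih =>
      intro p γ hq h
      have hq' : (0 : ℝ) < q := by exact_mod_cast hq
      have hp : (0 : ℝ) < p := by
        have := cf_pos γ
        rw [h] at this
        exact (div_pos_iff_of_pos_right hq').1 this
      have hp' : 0 < p := by exact_mod_cast hp
      have hlt : (p : ℝ) < q := by
        have := cf_lt_one γ
        rw [h, div_lt_one hq'] at this
        exact this
      have hcast : ((p.toNat : ℕ) : ℝ) = p := by
        have : ((p.toNat : ℤ) : ℝ) = p := by rw [Int.toNat_of_nonneg hp'.le]
        exact_mod_cast this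
      refine ih p.toNat ?_ (q - γ 0 * p) (fun k => γ (k + 1)) (by omega) ?_
      · have : p < q := by exact_mod_cast hlt
        omega
      · rw [cf_eq] at h
        have h3 := cf_pos (fun k => γ (k + 1))
        have h4 := one_le_pnat_cast (γ 0)
        rw [div_eq_div_iff (by positivity) hq'.ne'] at h
        rw [hcast, eq_div_iff hp.ne']
        push_cast
        linarith
  rintro ⟨r, hr⟩
  refine key r.den r.num γ r.den_pos ?_
  rw [← hr]
  exact_mod_cast (Rat.num_div_den r).symm

lemma half_lt_cf {γ : ℕ → ℕ+} (h : γ 0 = 1) : 1 / 2 < cf γ := by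
  rw [cf_eq, h]
  have h1 := cf_lt_one (fun k => γ (k + 1))
  have h2 := cf_pos (fun k => γ (k + 1))
  apply one_div_lt_one_div_of_lt <;> push_cast <;> linarith

lemma cf_lt_half {γ : ℕ → ℕ+} (h : γ 0 = 2) : cf γ < 1 / 2 := by
  rw [cf_eq, h]
  have h2 := cf_pos (fun k => γ (k + 1))
  apply one_div_lt_one_div_of_lt <;> push_cast <;> linarith

lemma cf_lt_cf_iff_tail {γ γ' : ℕ → ℕ+} (h : γ 0 = γ' 0) :
    cf γ < cf γ' ↔ cf (fun k => γ' (k + 1)) < cf (fun k => γ (k + 1)) := by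
  have h1 := cf_pos (fun k => γ (k + 1))
  have h2 := cf_pos (fun k => γ' (k + 1))
  rw [cf_eq γ, cf_eq γ', h, one_div_lt_one_div (by positivity) (by positivity), add_lt_add_iff_left]

/-! ### Bi-infinite sequences and quadratic forms -/

/-- The entries of a bi-infinite sequence to the right of position `i`. -/
def rightTail (a : ℤ → ℕ+) (i : ℤ) : ℕ → ℕ+ := fun k => a (i + 1 + k)

/-- The entries of a bi-infinite sequence to the left of position `i`, read leftwards. -/
def leftTail (a : ℤ → ℕ+) (i : ℤ) : ℕ → ℕ+ := fun k => a (i - 1 - k)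

/-- The height `a i + [0; a (i + 1), a (i + 2), …] + [0; a (i - 1), a (i - 2), …]`. -/
noncomputable def height (a : ℤ → ℕ+) (i : ℤ) : ℝ :=
  (a i : ℝ) + cf (rightTail a i) + cf (leftTail a i)

lemma cf_rightTail (a : ℤ → ℕ+) (i : ℤ) :
    cf (rightTail a i) = 1 / ((a (i + 1) : ℝ) + cf (rightTail a (i + 1))) := by
  rw [cf_eq]
  congr 3
  · simp [rightTail]
  · funext k
    simp only [rightTail]
    push_cast
    ring_nf

lemma cf_leftTail (a : ℤ → ℕ+) (i : ℤ) :
    cf (leftTail a i) = 1 / ((a (i - 1) : ℝ) + cf (leftTail a (i - 1))) := by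
  rw [cf_eq]
  congr 3
  · simp [leftTail]
  · funext k
    simp only [leftTail]
    push_cast
    ring_nf

lemma continuous_height (i : ℤ) : Continuous fun a => height a i := by
  unfold height
  refine ((?_ : Continuous _).add (continuous_cf.comp ?_)).add (continuous_cf.comp ?_)
  · exact (continuous_of_discreteTopology (f := fun n : ℕ+ => ((n : ℕ) : ℝ))).comp
      (continuous_apply i)
  · exact continuous_pi fun k => continuous_apply _
  · exact continuous_pi fun k => continuous_apply _

/-- The form `(x - ξ y) (x - η y)`, normalised to discriminant `1`, is at least `1 / m` in
absolute value on nonzero integer vectors. -/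
def FormBound (m ξ η : ℝ) : Prop :=
  ∀ x y : ℤ, (x, y) ≠ (0, 0) → |ξ - η| ≤ m * (|(x : ℝ) - ξ * y| * |(x : ℝ) - η * y|)

lemma FormBound.add_int {m ξ η : ℝ} (h : FormBound m ξ η) (k : ℤ) :
    FormBound m (ξ + k) (η + k) := by
  intro x y hxy
  have := h (x - k * y) y (by
    intro h0
    simp only [Prod.mk.injEq] at h0
    apply hxy
    obtain ⟨h1, rfl⟩ := h0
    simpa using h1)
  push_cast at this
  convert this using 2
  · ring
  · congr 2 <;> ring

lemma FormBound.inv {m ξ η : ℝ} (h : FormBound m ξ η) (hξ : ξ ≠ 0) (hη : η ≠ 0) :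
    FormBound m (1 / ξ) (1 / η) := by
  intro x y hxy
  have h1 := h y x (by
    intro h0
    simp only [Prod.mk.injEq] at h0
    exact hxy (by simp [h0.1, h0.2]))
  have e1 : |1 / ξ - 1 / η| = |ξ - η| / (|ξ| * |η|) := by
    rw [div_sub_div _ _ hξ hη, abs_div, abs_mul, abs_sub_comm]
    congr 2
    ring
  have e2 : |(x : ℝ) - 1 / ξ * y| = |(y : ℝ) - ξ * x| / |ξ| := by
    rw [← abs_div, ← abs_neg]
    congr 1
    field_simp
    ring
  have e3 : |(x : ℝ) - 1 / η * y| = |(y : ℝ) - η * x| / |η| := by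
    rw [← abs_div, ← abs_neg]
    congr 1
    field_simp
    ring
  rw [e1, e2, e3, div_mul_div_comm, ← mul_div_assoc]
  gcongr

lemma FormBound.le {m ξ η : ℝ} (h : FormBound m ξ η) : ξ - η ≤ m := by
  have := h 1 0 (by simp)
  norm_num at this
  exact (le_abs_self _).trans this

lemma FormBound.symm {m ξ η : ℝ} (h : FormBound m ξ η) : FormBound m η ξ := by
  intro x y hxy
  rw [abs_sub_comm, mul_comm |(x : ℝ) - η * y|]
  exact h x y hxy

lemma FormBound.irrational {m ξ η : ℝ} (h : FormBound m ξ η) (hne : ξ ≠ η) : Irrational ξ := by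
  rintro ⟨r, rfl⟩
  have h1 := h r.num r.den (by simp)
  have h2 : (r.num : ℝ) - r * ((r.den : ℤ) : ℝ) = 0 := by
    have : (r : ℝ) * r.den = r.num := by exact_mod_cast Rat.mul_den_eq_num r
    push_cast
    linarith
  rw [h2] at h1
  simp only [abs_zero, zero_mul, mul_zero] at h1
  exact hne (sub_eq_zero.1 (abs_eq_zero.1 (le_antisymm h1 (abs_nonneg _))))

/-- The infimum need not be attained, so a nearly minimal vector, made primitive, is moved to (1, 0)
by a unimodular substitution. The roots of the new form differ by 1/|A|, where A is its leading
coefficient. -/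
lemma exists_formBound {a b c : ℝ} (hd : b ^ 2 - 4 * a * c = 1) (hpos : 0 < formInf a b c)
    {ε : ℝ} (hε : 0 < ε) :
    ∃ ξ η, η < ξ ∧ FormBound (1 / formInf a b c) ξ η ∧ 1 / formInf a b c - ε < ξ - η := by
  set μ := formInf a b c with hμ
  have hle : ∀ x y : ℤ, (x, y) ≠ (0, 0) →
      μ ≤ |a * (x : ℝ) ^ 2 + b * (x : ℝ) * (y : ℝ) + c * (y : ℝ) ^ 2| := fun x y hxy =>
    csInf_le ⟨0, by rintro v ⟨x, y, -, rfl⟩; positivity⟩ ⟨x, y, hxy, rfl⟩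
  obtain ⟨v, ⟨x, y, hxy, rfl⟩, hlt⟩ := exists_lt_of_csInf_lt
    (s := {v : ℝ | ∃ x y : ℤ, (x, y) ≠ (0, 0) ∧
      v = |a * (x : ℝ) ^ 2 + b * (x : ℝ) * (y : ℝ) + c * (y : ℝ) ^ 2|})
    -- With this slack, (1/μ - ε)(μ + εμ²) = 1 - (εμ)² < 1, so 1/|A| > 1/μ - ε.
    (b := μ + ε * μ ^ 2) ⟨_, 1, 0, by simp, rfl⟩
    (by change μ < _; have : 0 < ε * μ ^ 2 := by positivity
        linarith)
  have hg : 0 < Int.gcd x y := by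
    rw [Nat.pos_iff_ne_zero, Ne, Int.gcd_eq_zero_iff]
    rintro ⟨rfl, rfl⟩
    exact hxy rfl
  obtain ⟨p, q, hpq, hxp, hyq⟩ := Int.exists_gcd_one hg
  set d := Int.gcd x y
  obtain ⟨u, v, huv⟩ := Int.isCoprime_iff_gcd_eq_one.2 hpq
  have huv' : (u : ℝ) * p + v * q = 1 := by exact_mod_cast huv
  -- Coefficients after substituting (pX - vY, qX + uY), of determinant pu + qv = 1.
  set A : ℝ := a * (p : ℝ) ^ 2 + b * p * q + c * (q : ℝ) ^ 2 with hA
  set B : ℝ := -2 * a * p * v + b * (p * u - q * v) + 2 * c * q * u with hB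
  set C : ℝ := a * (v : ℝ) ^ 2 - b * v * u + c * (u : ℝ) ^ 2 with hC
  have hdisc : B ^ 2 - 4 * A * C = 1 := by
    have : B ^ 2 - 4 * A * C = (b ^ 2 - 4 * a * c) * ((u : ℝ) * p + v * q) ^ 2 := by
      rw [hA, hB, hC]; ring
    rw [this, hd, huv']; norm_num
  have hpq0 : (p, q) ≠ (0, 0) := by
    intro h0
    simp only [Prod.mk.injEq] at h0
    rw [h0.1, h0.2] at huv
    simp at huv
  have hAμ : μ ≤ |A| := hle p q hpq0
  have hA0 : 0 < |A| := hpos.trans_le hAμ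
  have hAne : A ≠ 0 := abs_pos.1 hA0
  have hAlt : |A| < μ + ε * μ ^ 2 := by
    refine lt_of_le_of_lt ?_ hlt
    have e : a * (x : ℝ) ^ 2 + b * (x : ℝ) * (y : ℝ) + c * (y : ℝ) ^ 2 = (d : ℝ) ^ 2 * A := by
      rw [hxp, hyq, hA]; push_cast; ring
    rw [e, abs_mul, abs_of_nonneg (sq_nonneg (d : ℝ))]
    have h1 : (1 : ℝ) ≤ d := by exact_mod_cast hg
    exact le_mul_of_one_le_left hA0.le (one_le_pow₀ h1)
  have hAA : |A| * |A| = A * A := abs_mul_abs_self A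
  refine ⟨-B / (2 * A) + 1 / (2 * |A|), -B / (2 * A) - 1 / (2 * |A|), ?_, ?_, ?_⟩
  · have : 0 < 1 / (2 * |A|) := by positivity
    linarith
  · intro X Y hXY
    have hne : (p * X - v * Y, q * X + u * Y) ≠ ((0 : ℤ), (0 : ℤ)) := by
      intro h0
      simp only [Prod.mk.injEq] at h0
      apply hXY
      have h1 : X = u * (p * X - v * Y) + v * (q * X + u * Y) := by
        linear_combination (-X) * huv
      have h2 : Y = p * (q * X + u * Y) - q * (p * X - v * Y) := by
        linear_combination (-Y) * huv
      rw [h0.1, h0.2] at h1 h2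
      simp [h1, h2]
    have h1 := hle _ _ hne
    have h2 : a * ((p * X - v * Y : ℤ) : ℝ) ^ 2 + b * ((p * X - v * Y : ℤ) : ℝ)
        * ((q * X + u * Y : ℤ) : ℝ) + c * ((q * X + u * Y : ℤ) : ℝ) ^ 2
        = A * ((X - (-B / (2 * A) + 1 / (2 * |A|)) * Y) *
            (X - (-B / (2 * A) - 1 / (2 * |A|)) * Y)) := by
      have e1 : A * ((X - (-B / (2 * A) + 1 / (2 * |A|)) * Y) *
            (X - (-B / (2 * A) - 1 / (2 * |A|)) * Y))
          = A * ((X + B / (2 * A) * Y) ^ 2 - Y ^ 2 / (4 * (|A| * |A|))) := by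
        field_simp
        ring
      rw [e1, hAA]
      have e2 : A * ((X + B / (2 * A) * Y) ^ 2 - Y ^ 2 / (4 * (A * A)))
          = A * X ^ 2 + B * X * Y + (B ^ 2 - 1) / (4 * A) * Y ^ 2 := by
        field_simp
        ring
      have e3 : (B ^ 2 - 1) / (4 * A) = C := by
        rw [div_eq_iff (by positivity)]
        linarith
      rw [e2, e3, hA, hB, hC]
      push_cast
      ring
    rw [h2, abs_mul, abs_mul] at h1
    have e4 : |-B / (2 * A) + 1 / (2 * |A|) - (-B / (2 * A) - 1 / (2 * |A|))| = 1 / |A| := by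
      rw [← abs_of_pos (show 0 < 1 / |A| by positivity)]
      congr 1
      field_simp
      ring
    rw [e4, one_div_mul_eq_div, div_le_div_iff₀ hA0 hpos]
    linarith
  · have e : -B / (2 * A) + 1 / (2 * |A|) - (-B / (2 * A) - 1 / (2 * |A|)) = 1 / |A| := by
      field_simp
      ring
    rw [e]
    have h1 : 1 / μ - ε < 1 / (μ + ε * μ ^ 2) := by
      rw [lt_div_iff₀ (by positivity)]
      have : (1 / μ - ε) * (μ + ε * μ ^ 2) = 1 - (ε * μ) ^ 2 := by
        field_simp
        ring
      rw [this]
      have : 0 < (ε * μ) ^ 2 := by positivity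
      linarith
    exact h1.trans (one_div_lt_one_div_of_lt hA0 hAlt)

/-- The digits of ξ and -η form one bi-infinite sequence. Shifting it is an integer translation and
an inversion of the pair of roots, and both preserve `FormBound`; the vector (1, 0) then bounds
every height. -/
lemma exists_seq_of_formBound {m ξ η : ℝ} (h : FormBound m ξ η) (hgap : 2 < ξ - η) :
    ∃ a : ℤ → ℕ+, (∀ i, height a i ≤ m) ∧ height a 0 = ξ - η := by
  -- Once -1 < η < 0, the gap gives ξ > 1, so ⌊ξ⌋ is a legitimate digit.
  wlog hη : -1 < η ∧ η < 0 generalizing ξ η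
  · have hirr : Irrational η := h.symm.irrational (by linarith)
    have h1 := Int.ceil_lt_add_one η
    have h2 : η < ⌈η⌉ := lt_of_le_of_ne (Int.le_ceil η) (hirr.ne_int _)
    have h3 := h.add_int (-⌈η⌉)
    push_cast at h3
    obtain ⟨a, ha, ha0⟩ := this h3 (by linarith) ⟨by linarith, by linarith⟩
    exact ⟨a, ha, by rw [ha0]; ring⟩
  obtain ⟨hη1, hη0⟩ := hη
  have hξ : Irrational ξ := h.irrational (by linarith)
  have hηi : Irrational η := h.symm.irrational (by linarith)
  obtain ⟨γ, hγ⟩ := exists_cf_eq (x := Int.fract ξ) (hξ.sub_intCast _)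
    (lt_of_le_of_ne (Int.fract_nonneg _) (hξ.sub_intCast ⌊ξ⌋).ne_zero.symm) (Int.fract_lt_one _)
  obtain ⟨γ', hγ'⟩ := exists_cf_eq hηi.neg (by linarith) (by linarith)
  have hfl : 0 < ⌊ξ⌋ := Int.floor_pos.2 (by linarith)
  let a : ℤ → ℕ+ := fun i => match i with
    | .ofNat 0 => ⟨⌊ξ⌋.toNat, by omega⟩
    | .ofNat (n + 1) => γ n
    | .negSucc n => γ' n
  have ha0 : ((a 0 : ℕ) : ℝ) = ⌊ξ⌋ := by
    have : ((⌊ξ⌋.toNat : ℤ) : ℝ) = ⌊ξ⌋ := by rw [Int.toNat_of_nonneg hfl.le]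
    exact_mod_cast this
  have hr : rightTail a 0 = γ := by
    funext k
    have : (0 + 1 + k : ℤ) = Int.ofNat (k + 1) := by simp [add_comm]
    simp only [rightTail, this, a]
  have hl : leftTail a 0 = γ' := by
    funext k
    have : (0 - 1 - k : ℤ) = Int.negSucc k := by rw [Int.negSucc_eq]; ring
    simp only [leftTail, this, a]
  have key0 : FormBound m ((a 0 : ℝ) + cf (rightTail a 0)) (-cf (leftTail a 0)) := by
    rw [hr, hl, hγ, hγ', ha0, Int.floor_add_fract, neg_neg]
    exact h
  have hpos : ∀ i, 0 < (a i : ℝ) + cf (rightTail a i) := fun i => by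
    have := cf_pos (rightTail a i)
    positivity
  have key : ∀ i, FormBound m ((a i : ℝ) + cf (rightTail a i)) (-cf (leftTail a i)) := by
    intro i
    induction i using Int.induction_on with
    | zero => exact key0
    | succ i ih =>
      have h1 := ih.add_int (-(a i : ℕ))
      have hl := cf_pos (leftTail a i)
      have h2 := h1.inv (by push_cast; linarith [cf_pos (rightTail a i)])
        (by push_cast; have := one_le_pnat_cast (a i); linarith)
      convert h2 using 1
      · push_cast
        rw [add_neg_cancel_comm, cf_rightTail a i, one_div_one_div]
      · rw [cf_leftTail a (i + 1), add_sub_cancel_right]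
        push_cast
        rw [← neg_add_rev, one_div_neg_eq_neg_one_div]
    | pred i ih =>
      have hl := cf_pos (leftTail a (-i))
      have h1 := ih.inv (hpos _).ne' (by linarith)
      have h2 := h1.add_int (a (-i - 1) : ℕ)
      convert h2 using 1
      · have := cf_rightTail a (-i - 1)
        rw [sub_add_cancel] at this
        rw [this]
        push_cast
        ring
      · rw [one_div_neg_eq_neg_one_div, cf_leftTail a (-i), one_div_one_div]
        push_cast
        ring
  refine ⟨a, fun i => ?_, ?_⟩
  · have := (key i).le
    unfold height
    linarith
  · rw [height, hr, hl, hγ, hγ', ha0, Int.floor_add_fract]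
    ring

/-- √13 is the height of the constant sequence 3. Below about √13 a single 3 forces both neighbours
to be 3, hence the whole sequence. -/
lemma le_two_of_height_le {a : ℤ → ℕ+} {m : ℝ} (h : ∀ i, height a i ≤ m) (hm : m < √13)
    (i : ℤ) : a i ≤ 2 := by
  have h13 : √13 < 3.6056 := by
    rw [Real.sqrt_lt' (by norm_num)]; norm_num
  have h3 : ∀ i, a i ≤ 3 := by
    intro i
    by_contra! hc
    have h1 : (4 : ℝ) ≤ (a i : ℝ) := by exact_mod_cast hc
    have h2 := h i
    have h4 := cf_pos (rightTail a i)
    have h5 := cf_pos (leftTail a i)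
    unfold height at h2
    linarith
  have hcast : ∀ i, (a i : ℝ) ≤ 3 := fun i => by exact_mod_cast h3 i
  -- Successive bounds for tails with digits at most 3: 1/4 = 1/(3 + 1), 4/5 = 1/(1 + 1/4), 5/19 =
  -- 1/(3 + 4/5).
  have hlow : ∀ x y : ℝ, ∀ n : ℕ+, (n : ℝ) ≤ 3 → 0 < y → y ≤ 4 / 5 →
      x = 1 / ((n : ℝ) + y) → 5 / 19 ≤ x := by
    intro x y n hn hy0 hy1 hx
    have := one_le_pnat_cast n
    rw [hx, le_div_iff₀ (by linarith)]
    linarith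
  have hup : ∀ x y : ℝ, ∀ n : ℕ+, 1 / 4 ≤ y → x = 1 / ((n : ℝ) + y) → x ≤ 4 / 5 := by
    intro x y n hy hx
    have := one_le_pnat_cast n
    rw [hx, div_le_iff₀ (by linarith)]
    linarith
  have hquarter : ∀ x y : ℝ, ∀ n : ℕ+, (n : ℝ) ≤ 3 → 0 < y → y < 1 →
      x = 1 / ((n : ℝ) + y) → 1 / 4 ≤ x := by
    intro x y n hn hy0 hy1 hx
    have := one_le_pnat_cast n
    rw [hx, le_div_iff₀ (by linarith)]
    linarith
  -- 0.3425 is just above 0.6056 - 5/19, what remains for one tail once the other takes its least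
  -- value.
  have hthree : ∀ x y : ℝ, ∀ n : ℕ+, n ≤ 3 → y ≤ 4 / 5 → 0 < y → x ≤ 0.3425 →
      x = 1 / ((n : ℝ) + y) → n = 3 := by
    intro x y n hn hy hy0 hx he
    rw [he, div_le_iff₀ (by have := one_le_pnat_cast n; linarith)] at hx
    have h1 : (2 : ℝ) < n := by linarith
    have h2 : 2 < n := by exact_mod_cast h1
    exact le_antisymm hn (by exact_mod_cast h2)
  have hR4 : ∀ i, 1 / 4 ≤ cf (rightTail a i) := fun i =>
    hquarter _ _ _ (hcast _) (cf_pos _) (cf_lt_one _) (cf_rightTail a i)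
  have hL4 : ∀ i, 1 / 4 ≤ cf (leftTail a i) := fun i =>
    hquarter _ _ _ (hcast _) (cf_pos _) (cf_lt_one _) (cf_leftTail a i)
  have hR : ∀ i, cf (rightTail a i) ≤ 4 / 5 := fun i => hup _ _ _ (hR4 _) (cf_rightTail a i)
  have hL : ∀ i, cf (leftTail a i) ≤ 4 / 5 := fun i => hup _ _ _ (hL4 _) (cf_leftTail a i)
  have hR5 : ∀ i, 5 / 19 ≤ cf (rightTail a i) := fun i =>
    hlow _ _ _ (hcast _) (cf_pos _) (hR _) (cf_rightTail a i)
  have hL5 : ∀ i, 5 / 19 ≤ cf (leftTail a i) := fun i =>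
    hlow _ _ _ (hcast _) (cf_pos _) (hL _) (cf_leftTail a i)
  by_contra! hc
  have hsum : ∀ j, a j = 3 → cf (rightTail a j) + cf (leftTail a j) < 0.6056 := by
    intro j hj
    have h1 := h j
    rw [height, hj] at h1
    push_cast at h1
    linarith
  have hnext : ∀ j, a j = 3 → a (j + 1) = 3 := fun j hj =>
    hthree _ _ _ (h3 _) (hR _) (cf_pos _) (by linarith [hsum j hj, hL5 j]) (cf_rightTail a j)
  have hprev : ∀ j, a j = 3 → a (j - 1) = 3 := fun j hj =>
    hthree _ _ _ (h3 _) (hL _) (cf_pos _) (by linarith [hsum j hj, hR5 j]) (cf_leftTail a j)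
  have hi : a i = 3 := le_antisymm (h3 i) (by exact_mod_cast hc)
  have hr : rightTail a i = fun _ => 3 := by
    funext k
    simp only [rightTail]
    induction k with
    | zero => simpa using hnext i hi
    | succ k ih => simpa [add_assoc] using hnext _ ih
  have hl : leftTail a i = fun _ => 3 := by
    funext k
    simp only [leftTail]
    induction k with
    | zero => simpa using hprev i hi
    | succ k ih => simpa [sub_sub, add_assoc] using hprev _ ih
  have hx := cf_eq (fun _ => 3)
  have hx0 := cf_pos (fun _ => 3)
  have hm' := h i
  rw [height, hr, hl, hi] at hm'
  set x := cf (fun _ => 3)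
  push_cast at hx hm'
  rw [eq_div_iff (by positivity)] at hx
  have : √13 = 3 + x + x := by
    rw [Real.sqrt_eq_iff_mul_self_eq (by norm_num) (by positivity)]
    linarith
  linarith

/-- Near-minimal vectors give sequences with height at 0 close to m; compactness of {1, 2}^ℤ and
continuity of heights give one where m is attained. -/
lemma exists_height_eq_of_mem_markovSpectrum {m : ℝ} (hm : m ∈ markovSpectrum) (h3 : 3 < m)
    (h13 : m < √13) :
    ∃ a : ℤ → ℕ+, (∀ i, a i = 1 ∨ a i = 2) ∧ (∀ i, height a i ≤ m) ∧ height a 0 = m := by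
  obtain ⟨a, b, c, hd, hpos, rfl⟩ := hm
  set m := 1 / formInf a b c
  let S : Set (ℤ → ℕ+) := Set.univ.pi (fun _ => {1, 2}) ∩ ⋂ i, {a | height a i ≤ m}
  have happrox : ∀ ε, 0 < ε → ε ≤ 1 → ∃ a ∈ S, m - ε < height a 0 := by
    intro ε hε hε1
    obtain ⟨ξ, η, -, hF, hgap⟩ := exists_formBound hd hpos hε
    obtain ⟨a, ha, ha0⟩ := exists_seq_of_formBound hF (by linarith)
    refine ⟨a, ⟨fun i _ => ?_, Set.mem_iInter.2 ha⟩, by rwa [ha0]⟩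
    have h2 := le_two_of_height_le ha h13 i
    have h1 := (a i).pos
    have h2' : (a i : ℕ) ≤ 2 := h2
    have : (a i : ℕ) = 1 ∨ (a i : ℕ) = 2 := by omega
    rcases this with h | h
    · exact Or.inl (PNat.eq h)
    · exact Or.inr (PNat.eq h)
  have hS : IsCompact S :=
    (isCompact_univ_pi fun _ => (Set.toFinite _).isCompact).inter_right
      (isClosed_iInter fun i => isClosed_le (continuous_height i) continuous_const)
  obtain ⟨a₁, ha₁, -⟩ := happrox 1 one_pos le_rfl
  obtain ⟨a, ha, hmax⟩ := hS.exists_isMaxOn ⟨a₁, ha₁⟩ (continuous_height 0).continuousOn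
  have hle : ∀ i, height a i ≤ m := fun i => (Set.mem_iInter.1 ha.2 i :)
  refine ⟨a, fun i => ha.1 i trivial, hle, le_antisymm (hle 0) ?_⟩
  by_contra! hlt
  obtain ⟨a', ha', h'⟩ := happrox (min 1 (m - height a 0)) (lt_min one_pos (by linarith))
    (min_le_left _ _)
  have h1 : height a' 0 ≤ height a 0 := hmax ha'
  have h2 := min_le_right 1 (m - height a 0)
  linarith

/-! ### Convergents and the Lagrange spectrum -/

/-- The numerators of the convergents `[0; γ 0, …, γ (n - 1)]`. -/
def cfNum (γ : ℕ → ℕ+) : ℕ → ℕ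
  | 0 => 0
  | 1 => 1
  | n + 2 => γ (n + 1) * cfNum γ (n + 1) + cfNum γ n

/-- The denominators of the convergents `[0; γ 0, …, γ (n - 1)]`. -/
def cfDen (γ : ℕ → ℕ+) : ℕ → ℕ
  | 0 => 1
  | 1 => γ 0
  | n + 2 => γ (n + 1) * cfDen γ (n + 1) + cfDen γ n

lemma cfDen_pos (γ : ℕ → ℕ+) (n : ℕ) : 0 < cfDen γ n := by
  induction n using Nat.twoStepInduction with
  | zero => exact one_pos
  | one => exact (γ 0).pos
  | more n h _ => exact Nat.add_pos_right _ h

lemma fib_le_cfNum (γ : ℕ → ℕ+) (n : ℕ) : Nat.fib n ≤ cfNum γ n := by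
  induction n using Nat.twoStepInduction with
  | zero => exact le_rfl
  | one => exact le_rfl
  | more n h h' =>
    rw [Nat.fib_add_two, cfNum, add_comm]
    exact add_le_add (h'.trans (Nat.le_mul_of_pos_left _ (γ _).pos)) h

lemma fib_le_cfDen (γ : ℕ → ℕ+) (n : ℕ) : Nat.fib n ≤ cfDen γ n := by
  induction n using Nat.twoStepInduction with
  | zero => exact Nat.zero_le _
  | one => exact (γ 0).pos
  | more n h h' =>
    rw [Nat.fib_add_two, cfDen, add_comm]
    exact add_le_add (h'.trans (Nat.le_mul_of_pos_left _ (γ _).pos)) h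

lemma tendsto_atTop_of_fib_le {u : ℕ → ℕ} (h : ∀ n, Nat.fib n ≤ u n) : Tendsto u atTop atTop := by
  refine tendsto_atTop_mono (fun n => ?_) (tendsto_sub_atTop_nat 1)
  have := Nat.le_fib_add_one n
  have := h n
  omega

lemma cfNum_mul_cfDen_sub (γ : ℕ → ℕ+) (n : ℕ) :
    (cfNum γ (n + 1) : ℤ) * cfDen γ n - cfNum γ n * cfDen γ (n + 1) = (-1) ^ n := by
  induction n with
  | zero => simp [cfNum, cfDen]
  | succ n ih =>
    rw [cfNum, cfDen, pow_succ, ← ih]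
    push_cast
    ring

lemma cfPre_succ_eq (γ : ℕ → ℕ+) (n : ℕ) {t : ℝ} (ht : 0 ≤ t) :
    cfPre (n + 1) γ t
      = (cfNum γ (n + 1) + t * cfNum γ n) / (cfDen γ (n + 1) + t * cfDen γ n) := by
  induction n generalizing t with
  | zero => simp [cfPre, cfNum, cfDen]
  | succ n ih =>
    have h1 := one_le_pnat_cast (γ (n + 1))
    have h2 : 0 < (γ (n + 1) : ℝ) + t := by linarith
    have h3 : (0 : ℝ) < cfDen γ (n + 1) := by exact_mod_cast cfDen_pos γ _
    have h4 : (0 : ℝ) < cfDen γ n := by exact_mod_cast cfDen_pos γ _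
    rw [cfPre_succ_last, ih (by positivity), cfNum, cfDen]
    push_cast
    rw [div_eq_div_iff (by positivity) (by positivity)]
    field_simp
    ring

lemma cfPre_zero_eq (γ : ℕ → ℕ+) (n : ℕ) : cfPre n γ 0 = cfNum γ n / cfDen γ n := by
  cases n with
  | zero => simp [cfPre, cfNum, cfDen]
  | succ n => rw [cfPre_succ_eq γ n le_rfl]; simp

lemma isCoprime_cfNum_cfDen (γ : ℕ → ℕ+) (n : ℕ) :
    IsCoprime (cfDen γ n : ℤ) (cfNum γ n : ℤ) := by
  have h := cfNum_mul_cfDen_sub γ n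
  have h2 : ((-1 : ℤ) ^ n) * (-1) ^ n = 1 := by rw [← mul_pow]; simp
  refine ⟨(-1) ^ n * cfNum γ (n + 1), -((-1) ^ n * cfDen γ (n + 1)), ?_⟩
  linear_combination (-1) ^ n * h + h2

lemma one_div_abs_cfDen_mul (γ : ℕ → ℕ+) (n : ℕ) :
    1 / |(cfDen γ (n + 1) : ℝ) * (cfDen γ (n + 1) * cf γ - cfNum γ (n + 1))|
      = γ (n + 1) + cf (fun k => γ (k + (n + 2))) + cfDen γ n / cfDen γ (n + 1) := by
  have hx := cf_tail (n + 1) γ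
  have hx0 := cf_pos (fun k => γ (k + (n + 1)))
  have h := cf_eq_cfPre (n + 1) γ
  rw [cfPre_succ_eq γ n hx0.le] at h
  have h5 : (γ (n + 1) : ℝ) + cf (fun k => γ (k + (n + 2)))
      = 1 / cf (fun k => γ (k + (n + 1))) := by rw [hx, one_div_one_div]
  rw [h5]
  set x := cf (fun k => γ (k + (n + 1)))
  have h3 : (0 : ℝ) < cfDen γ (n + 1) := by exact_mod_cast cfDen_pos γ _
  have h4 : (0 : ℝ) < cfDen γ n := by exact_mod_cast cfDen_pos γ _
  have hdet : (cfNum γ (n + 1) : ℝ) * cfDen γ n - cfNum γ n * cfDen γ (n + 1) = (-1) ^ n := by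
    exact_mod_cast cfNum_mul_cfDen_sub γ n
  have e : (cfDen γ (n + 1) : ℝ) * (cfDen γ (n + 1) * cf γ - cfNum γ (n + 1))
      = -((-1) ^ n) * (cfDen γ (n + 1) * x / (cfDen γ (n + 1) + x * cfDen γ n)) := by
    rw [h, ← hdet]
    field_simp
    ring
  rw [e, abs_mul, abs_neg, abs_pow, abs_neg, abs_one, one_pow, one_mul, abs_of_pos (by positivity)]
  field_simp

lemma convergent_add_cf (n : ℕ) (γ : ℕ → ℕ+) (k : ℕ) :
    ((Real.convergent ((k : ℝ) + cf γ) n : ℚ) : ℝ) = k + cfPre n γ 0 := by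
  have hfl : ∀ (k : ℕ) (γ : ℕ → ℕ+), ⌊(k : ℝ) + cf γ⌋ = k := fun k γ => by
    rw [Int.floor_natCast_add, Int.floor_eq_zero_iff.2 ⟨(cf_pos γ).le, cf_lt_one γ⟩, add_zero]
  induction n generalizing γ k with
  | zero => rw [Real.convergent, hfl]; simp [cfPre]
  | succ n ih =>
    have hfr : (Int.fract ((k : ℝ) + cf γ))⁻¹ = (γ 0 : ℝ) + cf (fun j => γ (j + 1)) := by
      rw [Int.fract, hfl, Int.cast_natCast, add_sub_cancel_left, cf_eq, one_div, inv_inv]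
    rw [Real.convergent, hfl, hfr]
    push_cast
    rw [ih, cfPre, one_div]

/-- Legendre's criterion makes p/q a convergent. The fraction need not be reduced, but a common
factor k multiplies the error by k². -/
lemma exists_cfDen_of_two_lt {γ : ℕ → ℕ+} (hγ : ∀ n, γ n ≤ 2) {p q : ℤ}
    (h : 2 < 1 / |(q : ℝ) * ((q : ℝ) * cf γ - p)|) :
    ∃ n, |q| = cfDen γ n ∧ |(q : ℝ) * ((q : ℝ) * cf γ - p)|
      = |(cfDen γ n : ℝ) * (cfDen γ n * cf γ - cfNum γ n)| := by
  have hq0 : q ≠ 0 := by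
    rintro rfl
    norm_num at h
  have hqr : (q : ℝ) ≠ 0 := by exact_mod_cast hq0
  set v := |(q : ℝ) * ((q : ℝ) * cf γ - p)| with hv
  have hvpos : 0 < v := by
    by_contra! hc
    have : v = 0 := le_antisymm hc (abs_nonneg _)
    rw [this] at h
    norm_num at h
  have hvlt : v < 1 / 2 := by
    rw [lt_div_iff₀ hvpos] at h
    linarith
  let r : ℚ := p / q
  have hden : ((r.den : ℤ)) ∣ q := by
    have := Rat.den_dvd p q
    rwa [Rat.divInt_eq_div] at this
  have hden' : ((r.den : ℝ)) ^ 2 ≤ (q : ℝ) ^ 2 := by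
    rw [sq_le_sq]
    have h1 := Int.le_of_dvd (abs_pos.2 hq0) ((dvd_abs _ _).2 hden)
    rw [Nat.abs_cast]
    exact_mod_cast h1
  have hrd : (0 : ℝ) < r.den := by exact_mod_cast r.den_pos
  have happ : |cf γ - r| < 1 / (2 * (r.den : ℝ) ^ 2) := by
    have e : |cf γ - r| = v / (q : ℝ) ^ 2 := by
      rw [hv, ← abs_of_nonneg (sq_nonneg (q : ℝ)), ← abs_div]
      congr 1
      simp only [r, Rat.cast_div, Rat.cast_intCast]
      field_simp
    rw [e, div_lt_div_iff₀ (by positivity) (by positivity)]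
    have : 0 < (q : ℝ) ^ 2 := by positivity
    calc v * (2 * (r.den : ℝ) ^ 2) ≤ v * (2 * (q : ℝ) ^ 2) := by gcongr
      _ < 1 * (q : ℝ) ^ 2 := by nlinarith
  obtain ⟨n, hn⟩ := Real.exists_rat_eq_convergent happ
  have hn' : (p : ℝ) / q = cfNum γ n / cfDen γ n := by
    have h1 := convergent_add_cf n γ 0
    rw [Nat.cast_zero, zero_add, ← hn, zero_add, cfPre_zero_eq] at h1
    rw [← h1]
    simp [r]
  have hdp : (0 : ℝ) < cfDen γ n := by exact_mod_cast cfDen_pos γ n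
  rw [div_eq_div_iff hqr hdp.ne'] at hn'
  have hcross : p * (cfDen γ n : ℤ) = cfNum γ n * q := by exact_mod_cast hn'
  obtain ⟨k, hk⟩ : (cfDen γ n : ℤ) ∣ q :=
    (isCoprime_cfNum_cfDen γ n).dvd_of_dvd_mul_left ⟨p, by rw [← hcross, mul_comm]⟩
  have hpk : p = cfNum γ n * k := by
    have hne : (cfDen γ n : ℤ) ≠ 0 := by exact_mod_cast (cfDen_pos γ n).ne'
    apply mul_right_cancel₀ hne
    rw [hcross, hk]
    ring
  have hvk : v = (k : ℝ) ^ 2 * |(cfDen γ n : ℝ) * (cfDen γ n * cf γ - cfNum γ n)| := by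
    rw [hv, ← abs_of_nonneg (sq_nonneg (k : ℝ)), ← abs_mul, hk, hpk]
    push_cast
    congr 1
    ring
  have hcast : ∀ n, (γ n : ℝ) ≤ 2 := fun n => by exact_mod_cast hγ n
  -- The reciprocal is at most 2 + 1 + 1 since digits are at most 2. Then k²/4 ≤ v < 1/2 leaves only
  -- k² = 1.
  have hquart : 1 / 4 ≤ |(cfDen γ n : ℝ) * (cfDen γ n * cf γ - cfNum γ n)| := by
    cases n with
    | zero =>
      simp only [cfDen, cfNum, Nat.cast_one, Nat.cast_zero, one_mul, sub_zero]
      rw [abs_of_pos (cf_pos γ), cf_eq]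
      have := hcast 0
      have := one_le_pnat_cast (γ 0)
      have := cf_lt_one (fun k => γ (k + 1))
      have := cf_pos (fun k => γ (k + 1))
      exact one_div_le_one_div_of_le (by linarith) (by linarith)
    | succ n =>
      have h1 := one_div_abs_cfDen_mul γ n
      have h3 : (0 : ℝ) < cfDen γ (n + 1) := by exact_mod_cast cfDen_pos γ _
      have h2 : (cfDen γ n : ℝ) / cfDen γ (n + 1) ≤ 1 := by
        rw [div_le_one h3]
        have : cfDen γ n ≤ cfDen γ (n + 1) := by
          cases n with
          | zero => exact (γ 0).pos
          | succ n =>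
            rw [cfDen]
            exact (Nat.le_mul_of_pos_left _ (γ _).pos).trans (Nat.le_add_right _ _)
        exact_mod_cast this
      have h4 := hcast (n + 1)
      have h5 := cf_lt_one (fun k => γ (k + (n + 2)))
      have h6 := cf_pos (fun k => γ (k + (n + 2)))
      have h7 := one_le_pnat_cast (γ (n + 1))
      have h8 : (0 : ℝ) ≤ (cfDen γ n : ℝ) / cfDen γ (n + 1) := by positivity
      rw [← one_div_one_div |_|, h1]
      exact one_div_le_one_div_of_le (by linarith) (by linarith)
  have hk2 : k ^ 2 = 1 := by
    have h1 : (k : ℝ) ^ 2 < 2 := by nlinarith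
    have h2 : k ^ 2 < 2 := by exact_mod_cast h1
    have h3 : k ≠ 0 := by
      rintro rfl
      simp at hk
      exact hq0 hk
    have : 0 < k ^ 2 := by positivity
    omega
  refine ⟨n, ?_, ?_⟩
  · rw [hk, abs_mul, Nat.abs_cast]
    have : |k| = 1 := by rw [← sq_eq_sq₀ (abs_nonneg _) zero_le_one, sq_abs, hk2, one_pow]
    rw [this, mul_one]
  · have : (k : ℝ) ^ 2 = 1 := by exact_mod_cast hk2
    rw [hvk, this, one_mul]

/-- The recursion for denominators, divided through, reads the digits backwards; this is how left
tails enter the approximation constants. -/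
lemma cfDen_div_cfDen (β : ℤ → ℕ+) (n : ℕ) :
    (cfDen (rightTail β (-1)) n : ℝ) / cfDen (rightTail β (-1)) (n + 1)
      = cfPre (n + 1) (leftTail β (n + 1)) 0 := by
  induction n with
  | zero => simp [cfDen, cfPre, rightTail, leftTail]
  | succ n ih =>
    have hpos : (0 : ℝ) < cfDen (rightTail β (-1)) (n + 1) := by exact_mod_cast cfDen_pos _ _
    have e : (fun k => leftTail β (((n + 1 : ℕ) : ℤ) + 1) (k + 1)) = leftTail β (n + 1) := by
      funext k
      simp only [leftTail]
      push_cast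
      ring_nf
    rw [cfPre, e, ← ih, cfDen]
    have e2 : leftTail β (((n + 1 : ℕ) : ℤ) + 1) 0 = rightTail β (-1) (n + 1) := by
      simp only [leftTail, rightTail]
      push_cast
      ring_nf
    rw [e2]
    push_cast
    field_simp

lemma abs_sub_height_le (β : ℤ → ℕ+) (n : ℕ) :
    |1 / |(cfDen (rightTail β (-1)) (n + 1) : ℝ) * (cfDen (rightTail β (-1)) (n + 1)
        * cf (rightTail β (-1)) - cfNum (rightTail β (-1)) (n + 1))|
      - height β (n + 1 : ℕ)| ≤ 2 * (1 / 2) ^ (n + 1) := by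
  rw [one_div_abs_cfDen_mul, cfDen_div_cfDen, height]
  have e1 : rightTail β (-1) (n + 1) = β (n + 1 : ℕ) := by
    simp only [rightTail]
    ring_nf
  have e2 : (fun k => rightTail β (-1) (k + (n + 2))) = rightTail β (n + 1 : ℕ) := by
    funext k
    simp only [rightTail]
    push_cast
    ring_nf
  rw [e1, e2, add_sub_add_left_eq_sub, cf_eq_cfPre (n + 1) (leftTail β (n + 1 : ℕ))]
  push_cast
  exact abs_cfPre_sub_le_pow _ _ zero_mem_unit (cf_mem _)

lemma mem_lagrangeSpectrum_of_heights {β : ℤ → ℕ+} (hβ : ∀ i, β i ≤ 2) {m : ℝ} (hm : 2 < m)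
    (hle : ∀ c > m, ∀ᶠ n : ℕ in atTop, height β n ≤ c)
    (hge : ∀ c < m, ∃ᶠ n : ℕ in atTop, c ≤ height β n) : m ∈ lagrangeSpectrum := by
  set γ := rightTail β (-1) with hγ
  refine ⟨cf γ, irrational_cf γ, le_antisymm ?_ ?_⟩
  · rw [← EReal.le_of_forall_lt_iff_le]
    intro c hc
    have hc : m < c := by exact_mod_cast hc
    apply limsup_le_of_le
    · isBoundedDefault
    · have h1 := (tendsto_add_atTop_nat 1).eventually (hle ((m + c) / 2) (by linarith))
      have h2 := ((tendsto_add_atTop_nat 1).eventually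
        (tendsto_two_mul_half_pow.eventually (gt_mem_nhds (show 0 < (c - m) / 2 by linarith))))
      obtain ⟨N, hN⟩ := eventually_atTop.1 (h1.and h2)
      -- Each early convergent excludes only finitely many q, and such q are invisible to the
      -- cofinite filter.
      have hfin : {q : ℤ | ∃ n ≤ N, |q| = cfDen γ n}.Finite := by
        have : {q : ℤ | ∃ n ≤ N, |q| = cfDen γ n}
            ⊆ ⋃ n ∈ Set.Iic N, ({(cfDen γ n : ℤ), -(cfDen γ n : ℤ)} : Set ℤ) := by
          rintro q ⟨n, hn, hq⟩
          exact Set.mem_biUnion hn (eq_or_eq_neg_of_abs_eq hq)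
        exact ((Set.finite_Iic N).biUnion fun _ _ => Set.toFinite _).subset this
      have hev : ∀ᶠ q : ℤ in cofinite, ¬ ∃ n ≤ N, |q| = cfDen γ n := hfin.compl_mem_cofinite
      filter_upwards [hev.prod_inr cofinite] with z hz
      rw [EReal.coe_le_coe_iff]
      by_contra! hlt
      obtain ⟨n, hn, hv⟩ := exists_cfDen_of_two_lt (γ := γ) (fun n => hβ _)
        (show 2 < 1 / |(z.2 : ℝ) * ((z.2 : ℝ) * cf γ - z.1)| by linarith)
      have hnN : N < n := by
        by_contra! h
        exact hz ⟨n, h, hn⟩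
      obtain ⟨k, rfl⟩ : ∃ k, n = k + 1 := ⟨n - 1, by omega⟩
      rw [hv] at hlt
      have h3 := (abs_le.1 (abs_sub_height_le β k)).2
      have h4 := hN k (by omega)
      simp only [← hγ] at h3
      linarith [h4.1, h4.2]
  · rw [← EReal.ge_of_forall_gt_iff_ge]
    intro c hc
    have hc : c < m := by exact_mod_cast hc
    apply le_limsup_of_frequently_le
    · have htend : Tendsto (fun n => ((cfNum γ n : ℤ), (cfDen γ n : ℤ))) atTop
          (cofinite ×ˢ cofinite) := by
        refine Tendsto.prodMk ?_ ?_
        · exact ((tendsto_natCast_atTop_atTop (R := ℤ)).comp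
            (tendsto_atTop_of_fib_le (fib_le_cfNum γ))).mono_right atTop_le_cofinite
        · exact ((tendsto_natCast_atTop_atTop (R := ℤ)).comp
            (tendsto_atTop_of_fib_le (fib_le_cfDen γ))).mono_right atTop_le_cofinite
      refine htend.frequently ?_
      have h2 := tendsto_two_mul_half_pow.eventually (gt_mem_nhds (show 0 < (m - c) / 2 by linarith))
      refine ((hge ((m + c) / 2) (by linarith)).and_eventually
        (h2.and (eventually_ge_atTop 1))).mono ?_
      rintro n ⟨h3, h4, h5⟩
      obtain ⟨k, rfl⟩ : ∃ k, n = k + 1 := ⟨n - 1, by omega⟩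
      have h6 := (abs_le.1 (abs_sub_height_le β k)).1
      simp only [← hγ] at h6
      rw [EReal.coe_le_coe_iff]
      push_cast at h6 h3 ⊢
      linarith
    · isBoundedDefault

/-! ### Concatenating windows -/

lemma abs_height_sub_le {a a' : ℤ → ℕ+} {i i' : ℤ} {n : ℕ}
    (h : ∀ j : ℤ, |j| ≤ n → a (i + j) = a' (i' + j)) :
    |height a i - height a' i'| ≤ 4 * (1 / 2) ^ n := by
  have h0 : a i = a' i' := by simpa using h 0 (by simp)
  have h1 : |cf (rightTail a i) - cf (rightTail a' i')| ≤ 2 * (1 / 2) ^ n :=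
    abs_cf_sub_le_pow n fun k hk => by
      have := h (1 + k) (by rw [abs_of_nonneg (by omega)]; omega)
      simpa only [rightTail, add_assoc] using this
  have h2 : |cf (leftTail a i) - cf (leftTail a' i')| ≤ 2 * (1 / 2) ^ n :=
    abs_cf_sub_le_pow n fun k hk => by
      have := h (-(1 + k)) (by rw [abs_neg, abs_of_nonneg (by omega)]; omega)
      simpa only [leftTail, sub_sub, ← sub_eq_add_neg] using this
  rw [height, height, h0, abs_le]
  rw [abs_le] at h1 h2
  constructor <;> linarith [h1.1, h1.2, h2.1, h2.2]

/-- A sequence whose heights have upper limit `m` along the positive integers is obtained by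
placing longer and longer windows of the sequences `c k` one after the other. -/
lemma mem_lagrangeSpectrum_of_windows {m : ℝ} (hm : 2 < m) {c : ℕ → ℤ → ℕ+} {l : ℕ → ℕ}
    (hc : ∀ k i, c k i = 1 ∨ c k i = 2) (hl : ∀ k i, (l k : ℤ) < |i| → c k i = 2)
    (hle : ∀ ε > 0, ∀ᶠ k in atTop, ∀ i, height (c k) i ≤ m + ε)
    (hge : ∀ ε > 0, ∀ᶠ k in atTop, m - ε ≤ height (c k) 0) : m ∈ lagrangeSpectrum := by
  -- Cell k is [s k, s (k + 1)), of length 2 R k; its window of radius l k sits at the centre t k,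
  -- with at least k entries of margin on each side.
  let R : ℕ → ℕ := fun k => l k + k + 1
  let s : ℕ → ℕ := fun k => ∑ j ∈ Finset.range k, 2 * R j
  have hs : ∀ k, s (k + 1) = s k + 2 * R k := fun k => Finset.sum_range_succ _ _
  have hR : ∀ k, R k = l k + k + 1 := fun k => rfl
  have hmono : StrictMono s := strictMono_nat_of_lt_succ fun k => by
    rw [hs, hR]
    omega
  -- This keeps every earlier window at least k places to the left of cell k.
  have hmono' : Monotone fun k => (s k : ℤ) - k := monotone_nat_of_le_succ fun k => by
    have h1 := hs k
    have h2 := hR k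
    push_cast
    omega
  let t : ℕ → ℤ := fun k => s k + R k
  have ht : ∀ k, t k = s k + R k := fun k => rfl
  classical
  let β : ℤ → ℕ+ := fun i => if ∃ k, |i - t k| ≤ l k ∧ c k (i - t k) = 1 then 1 else 2
  have hcell : ∀ k n : ℕ, n < k → ∀ i : ℤ, (s k : ℤ) ≤ i → i < s (k + 1) →
      |height β i - height (c k) (i - t k)| ≤ 4 * (1 / 2) ^ n := by
    intro k n hn i hi hi'
    apply abs_height_sub_le
    intro j hj
    have hjk := abs_le.1 hj
    have hother : ∀ k', |i + j - t k'| ≤ l k' → k' = k := by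
      intro k' hk'
      rw [abs_le] at hk'
      have e1 := ht k'
      have e2 := hR k'
      have e3 := hs k'
      rcases lt_trichotomy k' k with h | h | h
      · have h3 := hmono' (show k' + 1 ≤ k by omega)
        simp only at h3
        push_cast at h3
        omega
      · exact h
      · have h3 := hmono.monotone (show k + 1 ≤ k' by omega)
        omega
    have e : i - t k + j = i + j - t k := by ring
    rw [e]
    simp only [β]
    split_ifs with hex
    · obtain ⟨k', hk', hk1⟩ := hex
      rw [hother k' hk'] at hk1
      exact hk1.symm
    · push Not at hex
      by_cases hlt : |i + j - t k| ≤ l k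
      · exact ((hc k _).resolve_left (hex k hlt)).symm
      · exact (hl k _ (not_le.1 hlt)).symm
  have hfind : ∀ n : ℕ, ∃ k, s k ≤ n ∧ n < s (k + 1) := by
    intro n
    induction n with
    | zero => exact ⟨0, by simp [s], by have := hs 0; have := hR 0; omega⟩
    | succ n ih =>
      obtain ⟨k, h1, h2⟩ := ih
      by_cases h : n + 1 < s (k + 1)
      · exact ⟨k, by omega, h⟩
      · exact ⟨k + 1, by omega, by have := hmono (show k + 1 < k + 1 + 1 by omega); omega⟩
  have hsmall : ∀ ε : ℝ, 0 < ε → ∀ᶠ n : ℕ in atTop, 4 * (1 / 2 : ℝ) ^ n < ε := fun ε hε => by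
    filter_upwards [tendsto_two_mul_half_pow.eventually (gt_mem_nhds (half_pos hε))] with n hn
    linarith
  refine mem_lagrangeSpectrum_of_heights (β := β) (fun i => ?_) hm ?_ ?_
  · simp only [β]
    split_ifs
    · decide
    · exact le_rfl
  · intro x hx
    obtain ⟨N, hN⟩ := (hsmall ((x - m) / 2) (by linarith)).exists
    obtain ⟨K, hK⟩ := eventually_atTop.1
      ((hle ((x - m) / 2) (by linarith)).and (eventually_gt_atTop N))
    filter_upwards [eventually_ge_atTop (s K)] with n hn
    obtain ⟨k, hk1, hk2⟩ := hfind n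
    have hKk : K ≤ k := by
      by_contra! h
      have := hmono.monotone (show k + 1 ≤ K by omega)
      omega
    have h1 := (abs_le.1 (hcell k N (hK k hKk).2 n (by exact_mod_cast hk1)
      (by exact_mod_cast hk2))).2
    have h2 := (hK k hKk).1 (n - t k)
    linarith
  · intro x hx
    rw [frequently_atTop]
    intro N₀
    obtain ⟨N, hN⟩ := (hsmall ((m - x) / 2) (by linarith)).exists
    obtain ⟨k, hk1, hk2, hk3⟩ := ((hge ((m - x) / 2) (by linarith)).and
      ((eventually_gt_atTop N).and (eventually_ge_atTop N₀))).exists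
    have h2 := hs k
    have h3 := hR k
    refine ⟨s k + R k, by omega, ?_⟩
    have h1 := (abs_le.1 (hcell k N hk2 (t k) (by rw [ht]; omega) (by rw [ht]; omega))).1
    rw [sub_self] at h1
    push_cast
    have : t k = s k + R k := rfl
    rw [← this]
    linarith

/-! ### Test tails and extendable sequences -/

/-- The tail `1, 1, 2, 2, 2, …`. -/
def tailOne : ℕ → ℕ+ := fun k => if k < 2 then 1 else 2

/-- The tail `2, 2, 1, 2, 2, 2, …`. -/
def tailTwo : ℕ → ℕ+ := fun k => if k = 2 then 1 else 2

/-- The sequence `…, a (n - 1), a n, b 0, b 1, …`, with `b 0` at position `n + 1`. -/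
def graft (a : ℤ → ℕ+) (n : ℤ) (b : ℕ → ℕ+) : ℤ → ℕ+ :=
  fun i => if i ≤ n then a i else b (i - n - 1).toNat

lemma graft_of_le {a : ℤ → ℕ+} {n : ℤ} {b : ℕ → ℕ+} {i : ℤ} (h : i ≤ n) :
    graft a n b i = a i := if_pos h

lemma graft_of_eq_add {a : ℤ → ℕ+} {n : ℤ} {b : ℕ → ℕ+} {i : ℤ} (k : ℕ) (h : i = n + 1 + k) :
    graft a n b i = b k := by
  rw [graft, if_neg (by omega)]
  congr 1
  omega

/-- Arbitrarily far to the right, the sequence can be continued by one of the two test tails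
while increasing the supremum of heights by an arbitrarily small amount. -/
def RightExtendable (a : ℤ → ℕ+) (m : ℝ) : Prop :=
  ∀ ε > 0, ∀ N : ℕ, ∃ n ≥ N, ∃ b, (b = tailOne ∨ b = tailTwo) ∧
    ∀ i, height (graft a (n : ℤ) b) i ≤ m + ε

/-- The reversed bi-infinite sequence. -/
def rev (a : ℤ → ℕ+) : ℤ → ℕ+ := fun i => a (-i)

lemma rightTail_rev (a : ℤ → ℕ+) (i : ℤ) : rightTail (rev a) i = leftTail a (-i) := by
  funext k
  simp only [rightTail, leftTail, rev]
  ring_nf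

lemma leftTail_rev (a : ℤ → ℕ+) (i : ℤ) : leftTail (rev a) i = rightTail a (-i) := by
  funext k
  simp only [rightTail, leftTail, rev]
  ring_nf

lemma height_rev (a : ℤ → ℕ+) (i : ℤ) : height (rev a) i = height a (-i) := by
  rw [height, height, rightTail_rev, leftTail_rev, add_right_comm]
  rfl

lemma testTail_eq_two {b : ℕ → ℕ+} (hb : b = tailOne ∨ b = tailTwo) {k : ℕ} (hk : 3 ≤ k) :
    b k = 2 := by
  rcases hb with rfl | rfl
  · exact if_neg (by omega)
  · exact if_neg (by omega)

lemma testTail_mem {b : ℕ → ℕ+} (hb : b = tailOne ∨ b = tailTwo) (k : ℕ) :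
    b k = 1 ∨ b k = 2 := by
  rcases hb with rfl | rfl
  · rw [tailOne]; split_ifs <;> simp
  · rw [tailTwo]; split_ifs <;> simp

lemma graft_mem {a : ℤ → ℕ+} (ha : ∀ i, a i = 1 ∨ a i = 2) {n : ℤ} {b : ℕ → ℕ+}
    (hb : b = tailOne ∨ b = tailTwo) (i : ℤ) : graft a n b i = 1 ∨ graft a n b i = 2 := by
  rw [graft]
  split_ifs
  · exact ha i
  · exact testTail_mem hb _

/-- Grafting on both sides beyond distance k yields windows that are eventually 2. Within distance k
of any index at most one of the two grafts is visible, so the one-sided height bounds suffice. -/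
lemma mem_lagrangeSpectrum_of_extendable {a : ℤ → ℕ+} (ha : ∀ i, a i = 1 ∨ a i = 2) {m : ℝ}
    (hm : 2 < m) (h0 : height a 0 = m) (hr : RightExtendable a m)
    (hl : RightExtendable (rev a) m) : m ∈ lagrangeSpectrum := by
  have hr' := fun k : ℕ => hr (1 / ((k : ℝ) + 1)) (by positivity) k
  have hl' := fun k : ℕ => hl (1 / ((k : ℝ) + 1)) (by positivity) k
  choose n hn b hb hbh using hr'
  choose n' hn' b' hb' hbh' using hl'
  let c : ℕ → ℤ → ℕ+ := fun k =>
    graft (rev (graft (rev a) (n' k) (b' k))) (n k) (b k)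
  have hrevm : ∀ i, rev a i = 1 ∨ rev a i = 2 := fun i => ha _
  have hright : ∀ k (j : ℤ), -(n' k : ℤ) ≤ j → c k j = graft a (n k) (b k) j := by
    intro k j hj
    simp only [c, graft]
    split_ifs
    · rw [rev, graft_of_le (by omega), rev, neg_neg]
    · rfl
  have hleft : ∀ k (j : ℤ), j ≤ n k → c k j = rev (graft (rev a) (n' k) (b' k)) j := by
    intro k j hj
    simp only [c]
    rw [graft_of_le hj]
  have hmid : ∀ k (j : ℤ), -(n' k : ℤ) ≤ j → j ≤ n k → c k j = a j := by
    intro k j hj hj'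
    rw [hright k j hj, graft_of_le hj']
  have hsmall : ∀ ε : ℝ, 0 < ε → ∀ᶠ n : ℕ in atTop, 4 * (1 / 2 : ℝ) ^ n < ε := fun ε hε => by
    filter_upwards [tendsto_two_mul_half_pow.eventually (gt_mem_nhds (half_pos hε))] with n hn
    linarith
  refine mem_lagrangeSpectrum_of_windows hm (c := c) (l := fun k => max (n k) (n' k) + 3)
    (fun k i => graft_mem (fun i => graft_mem hrevm (hb' k) _) (hb k) i) ?_ ?_ ?_
  · intro k i hi
    push_cast at hi
    rcases lt_abs.1 hi with h | h
    · have : i = n k + 1 + ((i - n k - 1).toNat : ℤ) := by omega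
      simp only [c]
      rw [graft_of_eq_add _ this]
      exact testTail_eq_two (hb k) (by omega)
    · have : -i = n' k + 1 + ((-i - n' k - 1).toNat : ℤ) := by omega
      rw [hleft k i (by omega), rev, graft_of_eq_add _ this]
      exact testTail_eq_two (hb' k) (by omega)
  · intro ε hε
    filter_upwards [hsmall (ε / 2) (half_pos hε),
      tendsto_one_div_add_atTop_nhds_zero_nat.eventually (gt_mem_nhds (half_pos hε))] with k h1 h2 i
    rcases le_total 0 i with hi | hi
    · have h3 : |height (c k) i - height (graft a (n k) (b k)) i| ≤ 4 * (1 / 2) ^ k := by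
        apply abs_height_sub_le
        intro j hj
        rw [abs_le] at hj
        have := hn' k
        exact hright k _ (by omega)
      have h4 := hbh k i
      linarith [(abs_le.1 h3).2]
    · have h3 : |height (c k) i - height (rev (graft (rev a) (n' k) (b' k))) i|
          ≤ 4 * (1 / 2) ^ k := by
        apply abs_height_sub_le
        intro j hj
        rw [abs_le] at hj
        have := hn k
        exact hleft k _ (by omega)
      have h4 := hbh' k (-i)
      rw [height_rev] at h3
      linarith [(abs_le.1 h3).2]
  · intro ε hε
    filter_upwards [hsmall ε hε] with k h1
    have h3 : |height (c k) 0 - height a 0| ≤ 4 * (1 / 2) ^ k := by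
      apply abs_height_sub_le
      intro j hj
      rw [abs_le] at hj
      have := hn k
      have := hn' k
      exact hmid k _ (by omega) (by omega)
    linarith [(abs_le.1 h3).1]

/-! ### Grafting between two sequences -/

/-- Iterated bounds: 1/3, then 3/4 = 1/(1 + 1/3), then 4/11 = 1/(2 + 3/4). They lead to 11/15 = 1/(1
+ 4/11) and 11/26 = 1/(2 + 4/11), and 2 + 11/15 + 11/26 < √10. -/
lemma four_elevenths_le_cf {γ : ℕ → ℕ+} (h : ∀ k, γ k = 1 ∨ γ k = 2) : 4 / 11 ≤ cf γ := by
  have hle : ∀ k, (γ k : ℝ) ≤ 2 := fun k => by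
    rcases h k with h | h <;> rw [h] <;> norm_num
  have h1 : 1 / 3 ≤ cf (fun k => γ (k + (1 + 1))) := by
    rw [cf_tail]
    have h1 := one_le_pnat_cast (γ 2)
    have h2 := cf_pos (fun k => γ (k + (2 + 1)))
    exact one_div_le_one_div_of_le (by positivity) (by linarith [hle 2, cf_lt_one (fun k => γ (k + (2 + 1)))])
  have h2 : cf (fun k => γ (k + 1)) ≤ 3 / 4 := by
    rw [cf_tail, div_le_iff₀] <;> linarith [one_le_pnat_cast (γ 1)]
  have h3 := cf_pos (fun k => γ (k + 1))
  have h4 := one_le_pnat_cast (γ 0)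
  rw [cf_eq, le_div_iff₀ (by linarith)]
  linarith [hle 0]

lemma cf_le_eleven_fifteenths {γ : ℕ → ℕ+} (h : ∀ k, γ k = 1 ∨ γ k = 2) : cf γ ≤ 11 / 15 := by
  have h1 := four_elevenths_le_cf fun k => h (k + 1)
  have h4 := one_le_pnat_cast (γ 0)
  rw [cf_eq, div_le_iff₀ (by linarith)]
  linarith

lemma cf_le_of_eq_two {γ : ℕ → ℕ+} (h : ∀ k, γ k = 1 ∨ γ k = 2) (h0 : γ 0 = 2) :
    cf γ ≤ 11 / 26 := by
  have h1 := four_elevenths_le_cf fun k => h (k + 1)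
  rw [cf_eq, h0]
  push_cast
  rw [div_le_iff₀ (by linarith)]
  linarith

/-- Only the middle entry of a block `1, 2, 1` can have height at least `√10`. -/
lemma height_lt_sqrt_ten {a : ℤ → ℕ+} (ha : ∀ i, a i = 1 ∨ a i = 2) {i : ℤ}
    (h : a i = 1 ∨ a (i + 1) = 2 ∨ a (i - 1) = 2) : height a i < √10 := by
  have h10 : 3.16 < √10 := by
    rw [Real.lt_sqrt (by norm_num)]
    norm_num
  have hr : ∀ k, rightTail a i k = 1 ∨ rightTail a i k = 2 := fun k => ha _
  have hl : ∀ k, leftTail a i k = 1 ∨ leftTail a i k = 2 := fun k => ha _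
  have h1 := cf_le_eleven_fifteenths hr
  have h2 := cf_le_eleven_fifteenths hl
  have h3 : (a i : ℝ) ≤ 2 := by rcases ha i with h | h <;> rw [h] <;> norm_num
  rw [height]
  rcases h with h | h | h
  · rw [h]
    push_cast
    linarith
  · have := cf_le_of_eq_two hr (by simpa [rightTail] using h)
    linarith
  · have := cf_le_of_eq_two hl (by simpa [leftTail] using h)
    linarith

lemma height_graft_lt_sqrt_ten {a : ℤ → ℕ+} (ha : ∀ i, a i = 1 ∨ a i = 2) {b : ℕ → ℕ+}
    (hb : b = tailOne ∨ b = tailTwo) {n i : ℤ} (hi : n < i) : height (graft a n b) i < √10 := by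
  apply height_lt_sqrt_ten (graft_mem ha hb)
  obtain ⟨k, hk⟩ : ∃ k : ℕ, i = n + 1 + k := ⟨(i - n - 1).toNat, by omega⟩
  have h1 : graft a n b (i + 1) = b (k + 1) := graft_of_eq_add _ (by push_cast; omega)
  rw [graft_of_eq_add k hk, h1]
  rcases hb with rfl | rfl
  · by_cases hk2 : k < 2
    · exact Or.inl (if_pos hk2)
    · exact Or.inr (Or.inl (if_neg (by omega)))
  · by_cases hk1 : k = 1
    · refine Or.inr (Or.inr ?_)
      rw [graft_of_eq_add 0 (by push_cast; omega)]
      exact if_neg (by omega)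
    · exact Or.inr (Or.inl (if_neg (by omega)))

/-- Dropping a common digit reverses the order, and comparison with 1/2 decides the next digit. -/
lemma start_of_cf_tailTwo_lt {γ : ℕ → ℕ+} (h : ∀ k, γ k = 1 ∨ γ k = 2) (h0 : γ 0 = 2)
    (hlt : cf tailTwo < cf γ) : γ 1 = 2 ∧ γ 2 = 1 ∧ γ 3 = 2 := by
  have e1 := (cf_lt_cf_iff_tail (show tailTwo 0 = γ 0 from h0.symm)).1 hlt
  have hb1 : cf (fun k => tailTwo (k + 1)) < 1 / 2 := cf_lt_half rfl
  have h1 : γ 1 = 2 := (h 1).resolve_left fun hc => by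
    have := half_lt_cf (γ := fun k => γ (k + 1)) hc
    linarith
  have e2 := (cf_lt_cf_iff_tail (γ := fun k => γ (k + 1)) (γ' := fun k => tailTwo (k + 1)) h1).1 e1
  have hb2 : 1 / 2 < cf (fun k => tailTwo (k + 1 + 1)) := half_lt_cf rfl
  have h2 : γ 2 = 1 := (h 2).resolve_right fun hc => by
    have := cf_lt_half (γ := fun k => γ (k + 1 + 1)) hc
    linarith
  have e3 := (cf_lt_cf_iff_tail (γ := fun k => tailTwo (k + 1 + 1)) (γ' := fun k => γ (k + 1 + 1))
    h2.symm).1 e2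
  have hb3 : cf (fun k => tailTwo (k + 1 + 1 + 1)) < 1 / 2 := cf_lt_half rfl
  refine ⟨h1, h2, (h 3).resolve_left fun hc => ?_⟩
  have := half_lt_cf (γ := fun k => γ (k + 1 + 1 + 1)) hc
  linarith

lemma start_of_cf_lt_cf_tailOne {γ : ℕ → ℕ+} (h : ∀ k, γ k = 1 ∨ γ k = 2) (h0 : γ 0 = 1)
    (hlt : cf γ < cf tailOne) : γ 1 = 1 ∧ γ 2 = 2 := by
  have e1 := (cf_lt_cf_iff_tail (show γ 0 = tailOne 0 from h0)).1 hlt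
  have hb1 : 1 / 2 < cf (fun k => tailOne (k + 1)) := half_lt_cf rfl
  have h1 : γ 1 = 1 := (h 1).resolve_right fun hc => by
    have := cf_lt_half (γ := fun k => γ (k + 1)) hc
    linarith
  have e2 := (cf_lt_cf_iff_tail (γ := fun k => tailOne (k + 1)) (γ' := fun k => γ (k + 1))
    h1.symm).1 e1
  have hb2 : cf (fun k => tailOne (k + 1 + 1)) < 1 / 2 := cf_lt_half rfl
  refine ⟨h1, (h 2).resolve_left fun hc => ?_⟩
  have := half_lt_cf (γ := fun k => γ (k + 1 + 1)) hc
  linarith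

/-- If a continuation of `a` after position `n` lies between those of `a` and `a'`, then the
heights of the grafted sequence are controlled by those of `a` and `a'`. -/
lemma height_graft_le {a a' : ℤ → ℕ+} {m m' ε : ℝ} {M n : ℕ} (ha : ∀ i, a i = 1 ∨ a i = 2)
    (hh : ∀ i, height a i ≤ m) (hh' : ∀ i, height a' i ≤ m') (hm : √10 < m)
    (hmm : m' ≤ m + ε / 2) (hM : 4 * (1 / 2) ^ M ≤ ε) (hn : 2 * M ≤ n)
    (hagree : ∀ j : ℤ, 0 ≤ j → j ≤ n → a j = a' j) {b : ℕ → ℕ+} (hb : b = tailOne ∨ b = tailTwo)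
    (h1 : cf (rightTail a n) ≤ cf b) (h2 : cf b ≤ cf (rightTail a' n)) (i : ℤ) :
    height (graft a n b) i ≤ m + ε := by
  have hε : 0 < ε := lt_of_lt_of_le (by positivity) hM
  rcases lt_or_ge (n : ℤ) i with hi | hi
  · linarith [height_graft_lt_sqrt_ten ha hb hi]
  -- For i < M the graft is at distance more than M, because n ≥ 2M.
  rcases lt_or_ge i M with hiM | hiM
  · have h3 : |height (graft a n b) i - height a i| ≤ 4 * (1 / 2) ^ M := by
      apply abs_height_sub_le
      intro j hj
      rw [abs_le] at hj
      exact graft_of_le (by omega)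
    linarith [(abs_le.1 h3).2, hh i]
  have hleft : leftTail (graft a n b) i = leftTail a i := by
    funext k
    exact graft_of_le (by omega)
  obtain ⟨r, hr⟩ : ∃ r : ℕ, (n : ℤ) = i + r := ⟨(n - i).toNat, by omega⟩
  have htail : ∀ c : ℤ → ℕ+, (fun k => rightTail c i (k + r)) = rightTail c n := by
    intro c
    funext k
    simp only [rightTail, hr]
    push_cast
    ring_nf
  have hg : rightTail (graft a n b) n = b := by
    funext k
    exact graft_of_eq_add k rfl
  have hmax := cf_le_max r (γ := rightTail (graft a n b) i) (γ₁ := rightTail a i)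
    (γ₂ := rightTail a' i) (fun k hk => graft_of_le (by omega))
    (fun k hk => by
      rw [rightTail, graft_of_le (by omega)]
      exact hagree _ (by omega) (by omega))
    (by rw [htail, htail, hg]; exact h1) (by rw [htail, htail, hg]; exact h2)
  rw [height, hleft, graft_of_le hi]
  rcases le_max_iff.1 hmax with h | h
  · have := hh i
    rw [height] at this
    linarith
  -- The left tails agree on the i ≥ M entries back to index 0, which costs ε/2; the other ε/2 is
  -- the slack between m and m'.
  · have h3 : |cf (leftTail a i) - cf (leftTail a' i)| ≤ 2 * (1 / 2) ^ M :=
      abs_cf_sub_le_pow M fun k hk => hagree _ (by omega) (by omega)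
    have h4 := hh' i
    rw [height, ← hagree i (by omega) hi] at h4
    linarith [(abs_le.1 h3).2]

/-- The value 1/2 separates the two tails, with `tailTwo` below it and `tailOne` above. As no graft
is admissible, `tailTwo` lies below the tail of a and `tailOne` above that of a'. -/
lemma branching_of_not_extendable {a a' : ℤ → ℕ+} {m m' ε : ℝ} {M n : ℕ}
    (ha : ∀ i, a i = 1 ∨ a i = 2) (ha' : ∀ i, a' i = 1 ∨ a' i = 2)
    (hh : ∀ i, height a i ≤ m) (hh' : ∀ i, height a' i ≤ m') (hm : √10 < m)
    (hmm : m' ≤ m + ε / 2) (hM : 4 * (1 / 2) ^ M ≤ ε) (hn : 2 * M ≤ n)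
    (hagree : ∀ j : ℤ, 0 ≤ j → j ≤ n → a j = a' j)
    (hbad : ∀ b, (b = tailOne ∨ b = tailTwo) → ∃ i, m + ε < height (graft a n b) i)
    (h2 : rightTail a n 0 = 2) (h1 : rightTail a' n 0 = 1) :
    (rightTail a n 1 = 2 ∧ rightTail a n 2 = 1 ∧ rightTail a n 3 = 2) ∧
      rightTail a' n 1 = 1 ∧ rightTail a' n 2 = 2 := by
  have hnot : ∀ b, (b = tailOne ∨ b = tailTwo) → cf (rightTail a n) ≤ cf b →
      cf b ≤ cf (rightTail a' n) → False := by
    intro b hb hle hge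
    obtain ⟨i, hi⟩ := hbad b hb
    exact hi.not_ge (height_graft_le ha hh hh' hm hmm hM hn hagree hb hle hge i)
  constructor
  · refine start_of_cf_tailTwo_lt (fun k => ha _) h2 ?_
    by_contra! h
    exact hnot _ (Or.inr rfl) h
      ((cf_lt_half (show tailTwo 0 = 2 from rfl)).trans (half_lt_cf h1)).le
  · refine start_of_cf_lt_cf_tailOne (fun k => ha' _) h1 ?_
    by_contra! h
    exact hnot _ (Or.inl rfl)
      ((cf_lt_half h2).trans (half_lt_cf (show tailOne 0 = 1 from rfl))).le h

/-! ### Dimension of branching sets -/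

/-- Sequences over `{1, 2}` that separate only as `…, 2, 2, 1, 2` against `…, 1, 1, 2`. -/
def Branching (T : Set (ℕ → ℕ+)) : Prop :=
  (∀ γ ∈ T, ∀ k, γ k = 1 ∨ γ k = 2) ∧
  ∀ γ ∈ T, ∀ γ' ∈ T, ∀ n, (∀ k < n, γ k = γ' k) → γ n = 2 → γ' n = 1 →
    (γ (n + 1) = 2 ∧ γ (n + 2) = 1 ∧ γ (n + 3) = 2) ∧ γ' (n + 1) = 1 ∧ γ' (n + 2) = 2

/-- The prefix acts as (3 + z)/(5 + 2z), of determinant -1, so it contracts by 1/25 < (3/5)^6. In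
`cfPre_four_contract` the rate is 1/361 < (2/5)^6. The sixth roots 3/5 and 2/5 of these bounds sum
to 1. -/
lemma cfPre_three_contract {γ : ℕ → ℕ+} (h0 : γ 0 = 1) (h1 : γ 1 = 1) (h2 : γ 2 = 2) {x y : ℝ}
    (hx : 0 ≤ x) (hy : 0 ≤ y) : |cfPre 3 γ x - cfPre 3 γ y| ≤ (3 / 5) ^ 6 * |x - y| := by
  have e : ∀ z : ℝ, 0 ≤ z → cfPre 3 γ z = (3 + z) / (5 + 2 * z) := by
    intro z hz
    simp only [cfPre, h0, h1, h2, Nat.zero_add, Nat.reduceAdd]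
    push_cast
    field_simp
    ring
  rw [e x hx, e y hy, div_sub_div _ _ (by positivity) (by positivity), abs_div,
    div_le_iff₀ (by positivity), abs_of_pos (show 0 < (5 + 2 * x) * (5 + 2 * y) by positivity)]
  have e2 : (3 + x) * (5 + 2 * y) - (5 + 2 * x) * (3 + y) = -(x - y) := by ring
  rw [e2, abs_neg]
  have : 25 ≤ (5 + 2 * x) * (5 + 2 * y) := by nlinarith [mul_nonneg hx hy]
  nlinarith [abs_nonneg (x - y)]

lemma cfPre_four_contract {γ : ℕ → ℕ+} (h0 : γ 0 = 2) (h1 : γ 1 = 2) (h2 : γ 2 = 1)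
    (h3 : γ 3 = 2) {x y : ℝ} (hx : 0 ≤ x) (hy : 0 ≤ y) :
    |cfPre 4 γ x - cfPre 4 γ y| ≤ (2 / 5) ^ 6 * |x - y| := by
  have e : ∀ z : ℝ, 0 ≤ z → cfPre 4 γ z = (8 + 3 * z) / (19 + 7 * z) := by
    intro z hz
    simp only [cfPre, h0, h1, h2, h3, Nat.zero_add, Nat.reduceAdd]
    push_cast
    field_simp
    ring
  rw [e x hx, e y hy, div_sub_div _ _ (by positivity) (by positivity), abs_div,
    div_le_iff₀ (by positivity), abs_of_pos (show 0 < (19 + 7 * x) * (19 + 7 * y) by positivity)]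
  have e2 : (8 + 3 * x) * (19 + 7 * y) - (19 + 7 * x) * (8 + 3 * y) = x - y := by ring
  rw [e2]
  have : 361 ≤ (19 + 7 * x) * (19 + 7 * y) := by nlinarith [mul_nonneg hx hy]
  nlinarith [abs_nonneg (x - y)]

lemma ediam_image_cf_le {U V : Set (ℕ → ℕ+)} {L : ℝ≥0} {n r : ℕ}
    (hUV : ∀ γ ∈ U, (fun k => γ (k + (n + r))) ∈ V)
    (hagree : ∀ γ ∈ U, ∀ γ' ∈ U, ∀ k < n + r, γ k = γ' k)
    (hL : ∀ γ ∈ U, ∀ x y : ℝ, 0 ≤ x → 0 ≤ y →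
      |cfPre r (fun k => γ (k + n)) x - cfPre r (fun k => γ (k + n)) y| ≤ L * |x - y|) :
    Metric.ediam (cf '' U) ≤ L * Metric.ediam (cf '' V) := by
  apply Metric.ediam_le
  rintro _ ⟨γ, hγ, rfl⟩ _ ⟨γ', hγ', rfl⟩
  have hag := hagree γ hγ γ' hγ'
  have key : |cf γ - cf γ'|
      ≤ L * |cf (fun k => γ (k + (n + r))) - cf (fun k => γ' (k + (n + r)))| := by
    refine (abs_cf_sub_le_tail n fun k hk => hag k (by omega)).trans ?_
    rw [cf_eq_cfPre r (fun k => γ (k + n)), cf_eq_cfPre r (fun k => γ' (k + n)),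
      ← cfPre_congr r (γ := fun k => γ (k + n)) (γ' := fun k => γ' (k + n))
        (fun k hk => hag (k + n) (by omega))]
    have e : ∀ δ : ℕ → ℕ+, (fun k => δ (k + r + n)) = fun k => δ (k + (n + r)) := fun δ => by
      funext k
      congr 1
      omega
    rw [e, e]
    exact hL γ hγ _ _ (cf_mem _).1 (cf_mem _).1
  calc edist (cf γ) (cf γ')
      ≤ L * edist (cf (fun k => γ (k + (n + r)))) (cf (fun k => γ' (k + (n + r)))) := by
        rw [edist_dist, edist_dist, Real.dist_eq, Real.dist_eq, ← ENNReal.ofReal_coe_nnreal,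
          ← ENNReal.ofReal_mul L.coe_nonneg]
        exact ENNReal.ofReal_le_ofReal key
    _ ≤ _ := by
        gcongr
        exact Metric.edist_le_ediam_of_mem ⟨_, hUV γ hγ, rfl⟩ ⟨_, hUV γ' hγ', rfl⟩

lemma sixth_power_mul_rpow (c x : ℝ≥0∞) : (c ^ 6 * x) ^ (1 / 6 : ℝ) = c * x ^ (1 / 6 : ℝ) := by
  rw [ENNReal.mul_rpow_of_nonneg _ _ (by norm_num), ← ENNReal.rpow_natCast, ← ENNReal.rpow_mul]
  norm_num

lemma Branching.tail {T : Set (ℕ → ℕ+)} (hT : Branching T) (n : ℕ)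
    (hag : ∀ γ ∈ T, ∀ γ' ∈ T, ∀ k < n, γ k = γ' k) :
    Branching ((fun γ k => γ (k + n)) '' T) := by
  refine ⟨?_, ?_⟩
  · rintro _ ⟨γ, hγ, rfl⟩ k
    exact hT.1 γ hγ _
  · rintro _ ⟨γ, hγ, rfl⟩ _ ⟨γ', hγ', rfl⟩ j hj h2 h1
    have := hT.2 γ hγ γ' hγ' (j + n) (fun k hk => by
      by_cases hkn : k < n
      · exact hag γ hγ γ' hγ' k hkn
      · have := hj (k - n) (by omega)
        simpa [Nat.sub_add_cancel (not_lt.1 hkn)] using this) h2 h1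
    simpa only [Nat.add_right_comm j n] using this

lemma Branching.mono {T T' : Set (ℕ → ℕ+)} (hT : Branching T) (h : T' ⊆ T) : Branching T' :=
  ⟨fun γ hγ => hT.1 γ (h hγ), fun γ hγ γ' hγ' => hT.2 γ (h hγ) γ' (h hγ')⟩

/-- At the first splitting index the set falls into two classes, each with a common forced block.
Covers of the tails past the blocks are pulled back; the sixth roots of the diameters scale by 3/5
and 2/5, so their total stays at most 1. -/
lemma Branching.exists_cover (N : ℕ) {T : Set (ℕ → ℕ+)} (hT : Branching T) :
    ∃ (ι : Type) (_ : Fintype ι) (U : ι → Set (ℕ → ℕ+)), T ⊆ ⋃ i, U i ∧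
      (∀ i, Metric.ediam (cf '' U i) ≤ ((3 / 5 : ℝ≥0) ^ 6 : ℝ≥0∞) ^ N) ∧
      ∑ i, Metric.ediam (cf '' U i) ^ (1 / 6 : ℝ) ≤ 1 := by
  induction N generalizing T with
  | zero =>
    have h1 : Metric.ediam (cf '' T) ≤ 1 := by
      apply Metric.ediam_le
      rintro _ ⟨γ, -, rfl⟩ _ ⟨γ', -, rfl⟩
      rw [edist_dist, ← ENNReal.ofReal_one, Real.dist_eq]
      apply ENNReal.ofReal_le_ofReal
      rw [abs_le]
      constructor <;> linarith [cf_pos γ, cf_pos γ', cf_lt_one γ, cf_lt_one γ']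
    refine ⟨Unit, inferInstance, fun _ => T, fun γ hγ => Set.mem_iUnion.2 ⟨(), hγ⟩,
      fun _ => by simpa using h1, ?_⟩
    simpa using ENNReal.rpow_le_one h1 (by norm_num)
  | succ N ih =>
    by_cases hsub : ∃ n, ∃ γ ∈ T, ∃ γ' ∈ T, γ n ≠ γ' n
    swap
    · push Not at hsub
      have h0 : Metric.ediam (cf '' T) = 0 := by
        apply Metric.ediam_subsingleton
        rintro _ ⟨γ, hγ, rfl⟩ _ ⟨γ', hγ', rfl⟩
        rw [show γ = γ' from funext fun n => hsub n γ hγ γ' hγ']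
      refine ⟨Unit, inferInstance, fun _ => T, fun γ hγ => Set.mem_iUnion.2 ⟨(), hγ⟩,
        fun _ => by simp [h0], ?_⟩
      simp [h0]
    classical
    set n := Nat.find hsub with hn
    have hag : ∀ γ ∈ T, ∀ γ' ∈ T, ∀ k < n, γ k = γ' k := by
      intro γ hγ γ' hγ' k hk
      by_contra hne
      exact Nat.find_min hsub hk ⟨γ, hγ, γ', hγ', hne⟩
    -- Both classes are nonempty, so every member of either has a partner to which the splitting
    -- rule applies.
    obtain ⟨γ₁, hγ₁, γ₂, hγ₂, h1, h2⟩ : ∃ γ₁ ∈ T, ∃ γ₂ ∈ T, γ₁ n = 1 ∧ γ₂ n = 2 := by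
      obtain ⟨γ, hγ, γ', hγ', hne⟩ := Nat.find_spec hsub
      rcases hT.1 γ hγ n with h | h <;> rcases hT.1 γ' hγ' n with h' | h'
      · exact absurd (h.trans h'.symm) hne
      · exact ⟨γ, hγ, γ', hγ', h, h'⟩
      · exact ⟨γ', hγ', γ, hγ, h', h⟩
      · exact absurd (h.trans h'.symm) hne
    let T₁ := {γ ∈ T | γ n = 1}
    let T₂ := {γ ∈ T | γ n = 2}
    have hs₁ : ∀ γ ∈ T₁, γ n = 1 ∧ γ (n + 1) = 1 ∧ γ (n + 2) = 2 := fun γ hγ =>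
      ⟨hγ.2, (hT.2 γ₂ hγ₂ γ hγ.1 n (hag _ hγ₂ _ hγ.1) h2 hγ.2).2⟩
    have hs₂ : ∀ γ ∈ T₂, γ n = 2 ∧ γ (n + 1) = 2 ∧ γ (n + 2) = 1 ∧ γ (n + 3) = 2 := fun γ hγ =>
      ⟨hγ.2, (hT.2 γ hγ.1 γ₁ hγ₁ n (hag _ hγ.1 _ hγ₁) hγ.2 h1).1⟩
    have hag₁ : ∀ γ ∈ T₁, ∀ γ' ∈ T₁, ∀ k < n + 3, γ k = γ' k := by
      intro γ hγ γ' hγ' k hk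
      obtain ⟨a0, a1, a2⟩ := hs₁ γ hγ
      obtain ⟨b0, b1, b2⟩ := hs₁ γ' hγ'
      rcases lt_or_ge k n with h | h
      · exact hag γ hγ.1 γ' hγ'.1 k h
      · obtain rfl | rfl | rfl : k = n ∨ k = n + 1 ∨ k = n + 2 := by omega
        · rw [a0, b0]
        · rw [a1, b1]
        · rw [a2, b2]
    have hag₂ : ∀ γ ∈ T₂, ∀ γ' ∈ T₂, ∀ k < n + 4, γ k = γ' k := by
      intro γ hγ γ' hγ' k hk
      obtain ⟨a0, a1, a2, a3⟩ := hs₂ γ hγ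
      obtain ⟨b0, b1, b2, b3⟩ := hs₂ γ' hγ'
      rcases lt_or_ge k n with h | h
      · exact hag γ hγ.1 γ' hγ'.1 k h
      · obtain rfl | rfl | rfl | rfl : k = n ∨ k = n + 1 ∨ k = n + 2 ∨ k = n + 3 := by omega
        · rw [a0, b0]
        · rw [a1, b1]
        · rw [a2, b2]
        · rw [a3, b3]
    obtain ⟨ι₁, _, U₁, hU₁, hd₁, hsum₁⟩ :=
      ih ((hT.mono (Set.sep_subset T _ : T₁ ⊆ T)).tail (n + 3) hag₁)
    obtain ⟨ι₂, _, U₂, hU₂, hd₂, hsum₂⟩ :=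
      ih ((hT.mono (Set.sep_subset T _ : T₂ ⊆ T)).tail (n + 4) hag₂)
    let W₁ : ι₁ → Set (ℕ → ℕ+) := fun i => {γ ∈ T₁ | (fun k => γ (k + (n + 3))) ∈ U₁ i}
    let W₂ : ι₂ → Set (ℕ → ℕ+) := fun i => {γ ∈ T₂ | (fun k => γ (k + (n + 4))) ∈ U₂ i}
    have hW₁ : ∀ i, Metric.ediam (cf '' W₁ i)
        ≤ ((3 / 5 : ℝ≥0) : ℝ≥0∞) ^ 6 * Metric.ediam (cf '' U₁ i) := by
      intro i
      have := ediam_image_cf_le (L := (3 / 5) ^ 6) (n := n) (r := 3) (U := W₁ i) (V := U₁ i)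
        (fun γ hγ => hγ.2) (fun γ hγ γ' hγ' => hag₁ γ hγ.1 γ' hγ'.1) (fun γ hγ x y hx hy => by
          obtain ⟨a0, a1, a2⟩ := hs₁ γ hγ.1
          push_cast
          refine cfPre_three_contract ?_ ?_ ?_ hx hy
          · simpa using a0
          · simpa [add_comm] using a1
          · simpa [add_comm] using a2)
      simpa only [ENNReal.coe_pow] using this
    have hW₂ : ∀ i, Metric.ediam (cf '' W₂ i)
        ≤ ((2 / 5 : ℝ≥0) : ℝ≥0∞) ^ 6 * Metric.ediam (cf '' U₂ i) := by
      intro i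
      have := ediam_image_cf_le (L := (2 / 5) ^ 6) (n := n) (r := 4) (U := W₂ i) (V := U₂ i)
        (fun γ hγ => hγ.2) (fun γ hγ γ' hγ' => hag₂ γ hγ.1 γ' hγ'.1) (fun γ hγ x y hx hy => by
          obtain ⟨a0, a1, a2, a3⟩ := hs₂ γ hγ.1
          push_cast
          refine cfPre_four_contract ?_ ?_ ?_ ?_ hx hy
          · simpa using a0
          · simpa [add_comm] using a1
          · simpa [add_comm] using a2
          · simpa [add_comm] using a3)
      simpa only [ENNReal.coe_pow] using this
    refine ⟨ι₁ ⊕ ι₂, inferInstance, Sum.elim W₁ W₂, ?_, ?_, ?_⟩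
    · intro γ hγ
      rw [Set.mem_iUnion]
      rcases hT.1 γ hγ n with h | h
      · obtain ⟨i, hi⟩ := Set.mem_iUnion.1 (hU₁ ⟨γ, ⟨hγ, h⟩, rfl⟩)
        exact ⟨Sum.inl i, ⟨hγ, h⟩, hi⟩
      · obtain ⟨i, hi⟩ := Set.mem_iUnion.1 (hU₂ ⟨γ, ⟨hγ, h⟩, rfl⟩)
        exact ⟨Sum.inr i, ⟨hγ, h⟩, hi⟩
    · rintro (i | i)
      · rw [pow_succ']
        exact (hW₁ i).trans (by gcongr; exact hd₁ i)
      · rw [pow_succ']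
        refine (hW₂ i).trans (mul_le_mul' (pow_le_pow_left' ?_ 6) (hd₂ i))
        rw [ENNReal.coe_le_coe]
        exact div_le_div_of_nonneg_right (by norm_num) (by norm_num)
    · rw [Fintype.sum_sum_type]
      have hsum : ∀ {ι : Type} [Fintype ι] {W U : ι → Set (ℕ → ℕ+)} {c : ℝ≥0∞},
          (∀ i, Metric.ediam (cf '' W i) ≤ c ^ 6 * Metric.ediam (cf '' U i)) →
          ∑ i, Metric.ediam (cf '' U i) ^ (1 / 6 : ℝ) ≤ 1 →
          ∑ i, Metric.ediam (cf '' W i) ^ (1 / 6 : ℝ) ≤ c := by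
        intro ι _ W U c h hU
        calc _ ≤ ∑ i, c * Metric.ediam (cf '' U i) ^ (1 / 6 : ℝ) := by
              gcongr with i
              rw [← sixth_power_mul_rpow]
              exact ENNReal.rpow_le_rpow (h i) (by norm_num)
          _ ≤ c * 1 := by rw [← Finset.mul_sum]; gcongr
          _ = c := mul_one c
      calc _ ≤ ((3 / 5 : ℝ≥0) : ℝ≥0∞) + ((2 / 5 : ℝ≥0) : ℝ≥0∞) :=
            add_le_add (hsum hW₁ hsum₁) (hsum hW₂ hsum₂)
        _ = 1 := by
            rw [← ENNReal.coe_add, ← add_div]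
            norm_num

lemma Branching.dimH_le {T : Set (ℕ → ℕ+)} (hT : Branching T) :
    dimH (cf '' T) ≤ ((1 / 6 : ℝ≥0) : ℝ≥0∞) := by
  apply dimH_le_of_hausdorffMeasure_ne_top
  choose ι hι U hU hd hsum using fun N => hT.exists_cover N
  have hr : Tendsto (fun N : ℕ => (((3 / 5 : ℝ≥0) : ℝ≥0∞) ^ 6) ^ N) atTop (𝓝 0) := by
    apply ENNReal.tendsto_pow_atTop_nhds_zero_of_lt_one
    apply pow_lt_one₀ (zero_le) _ (by norm_num)
    rw [ENNReal.coe_lt_one_iff, div_lt_one (by norm_num)]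
    norm_num
  have h := MeasureTheory.Measure.hausdorffMeasure_le_liminf_sum (1 / 6 : ℝ) (cf '' T) _ hr
    (fun N i => cf '' U N i) (Eventually.of_forall hd) (Eventually.of_forall fun N => by
      rw [← Set.image_iUnion]
      exact Set.image_mono (hU N))
  have h1 : liminf (fun N => ∑ i, Metric.ediam (cf '' U N i) ^ (1 / 6 : ℝ)) atTop ≤ 1 :=
    (liminf_le_liminf (Eventually.of_forall hsum)).trans (liminf_const 1).le
  have e : ((1 / 6 : ℝ≥0) : ℝ) = 1 / 6 := by push_cast; rfl
  rw [e]
  exact ((h.trans h1).trans_lt ENNReal.one_lt_top).ne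

/-! ### Obstructed tails and the conclusion -/

/-- The right halves of the sequences that are not extendable to the right, with all the data
that determine the heights of grafted sequences up to a small error prescribed. -/
def obstructedTails (N j : ℕ) (z : ℤ) (u : List ℕ+) : Set (ℕ → ℕ+) :=
  {γ | ∃ (a : ℤ → ℕ+) (m : ℝ), γ = rightTail a 0 ∧ a 0 = 2 ∧ (∀ i, a i = 1 ∨ a i = 2) ∧
    (∀ i, height a i ≤ m) ∧ √10 < m ∧ 4 * (1 / 2) ^ N ≤ 1 / ((j : ℝ) + 1) ∧
    ⌊m / (1 / ((j : ℝ) + 1) / 2)⌋ = z ∧ (List.range (2 * N)).map γ = u ∧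
    ∀ n ≥ N, ∀ b, (b = tailOne ∨ b = tailTwo) →
      ∃ i, m + 1 / ((j : ℝ) + 1) < height (graft a (n : ℤ) b) i}

lemma branching_obstructedTails (N j : ℕ) (z : ℤ) (u : List ℕ+) :
    Branching (obstructedTails N j z u) := by
  refine ⟨?_, ?_⟩
  · rintro _ ⟨a, m, rfl, -, ha, -⟩ k
    exact ha _
  · rintro _ ⟨a, m, rfl, ha0, ha, hh, hm, hN, hz, hu, hbad⟩ _
      ⟨a', m', rfl, ha0', ha', hh', -, -, hz', hu', -⟩ n hag h2 h1
    have hε : 0 < 1 / ((j : ℝ) + 1) := by positivity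
    set ε := 1 / ((j : ℝ) + 1)
    -- The prescribed prefix u rules out a split among the first 2N entries.
    have hn : 2 * N ≤ n := by
      by_contra! hlt
      have := List.map_inj_left.1 (hu.trans hu'.symm) n (List.mem_range.2 hlt)
      rw [h2, h1] at this
      exact absurd this (by decide)
    -- Equal floors put m and m' within ε/2 of each other.
    have hmm : m' ≤ m + ε / 2 := by
      have h3 := Int.abs_sub_lt_one_of_floor_eq_floor (hz'.trans hz.symm)
      rw [← sub_div, abs_lt, div_lt_one (by positivity)] at h3
      linarith [h3.2]
    -- Entry n of the right tail sits at position n + 1, so agreement covers positions 0 to n,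
    -- position 0 by the normalisation to 2.
    have hagree : ∀ i : ℤ, 0 ≤ i → i ≤ n → a i = a' i := by
      intro i hi hin
      rcases hi.eq_or_lt with rfl | hpos
      · rw [ha0, ha0']
      · have := hag (i - 1).toNat (by omega)
        simp only [rightTail] at this
        rwa [show (0 + 1 + ((i - 1).toNat : ℤ)) = i by omega] at this
    have e : ∀ (c : ℤ → ℕ+) (k : ℕ), rightTail c n k = rightTail c 0 (n + k) := by
      intro c k
      simp only [rightTail]
      push_cast
      ring_nf
    have := branching_of_not_extendable ha ha' hh hh' hm hmm hN hn hagree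
      (hbad n (by omega)) (by rw [e]; exact h2) (by rw [e]; exact h1)
    simpa only [e] using this

/-- Shrinking ε to some 1/(j + 1) and enlarging N preserves the obstruction, so the data range over
a countable set. -/
lemma exists_obstructedTails {a : ℤ → ℕ+} {m : ℝ} (ha : ∀ i, a i = 1 ∨ a i = 2) (h0 : a 0 = 2)
    (hh : ∀ i, height a i ≤ m) (hm : √10 < m) (hex : ¬ RightExtendable a m) :
    ∃ N j z u, rightTail a 0 ∈ obstructedTails N j z u := by
  unfold RightExtendable at hex
  push Not at hex
  obtain ⟨ε, hε, N, hN⟩ := hex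
  obtain ⟨j, hj⟩ := exists_nat_one_div_lt hε
  have hj0 : 0 < 1 / ((j : ℝ) + 1) := by positivity
  obtain ⟨N', hN', hN'N⟩ := ((tendsto_two_mul_half_pow.eventually
    (gt_mem_nhds (half_pos hj0))).and (eventually_ge_atTop N)).exists
  refine ⟨N', j, _, _, a, m, rfl, h0, ha, hh, hm, by linarith, rfl, rfl, ?_⟩
  intro n hn b hb
  obtain ⟨i, hi⟩ := hN n (hN'N.trans hn) b hb
  exact ⟨i, by linarith⟩

theorem propositionp :
    ∃ K : Set ℝ, dimH K < ENNReal.ofReal 0.174813 ∧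
      (markovSpectrum \ lagrangeSpectrum) ∩ Set.Ioo (Real.sqrt 10) (Real.sqrt 13) ⊆
        contFracCantor {1, 2} + K := by
  refine ⟨⋃ d : ℕ × ℕ × ℤ × List ℕ+,
    (fun x => 2 + x) '' (cf '' obstructedTails d.1 d.2.1 d.2.2.1 d.2.2.2), ?_, ?_⟩
  · rw [dimH_iUnion]
    refine lt_of_le_of_lt (iSup_le fun d => ?_)
      (show ((1 / 6 : ℝ≥0) : ℝ≥0∞) < ENNReal.ofReal 0.174813 from ?_)
    · rw [(isometry_add_left (2 : ℝ)).dimH_image]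
      exact (branching_obstructedTails _ _ _ _).dimH_le
    · rw [← ENNReal.ofReal_coe_nnreal, ENNReal.ofReal_lt_ofReal_iff (by norm_num)]
      push_cast
      norm_num
  · rintro m ⟨⟨hM, hL⟩, h10, h13⟩
    have h3 : 3 < m := by
      refine lt_trans ?_ h10
      rw [Real.lt_sqrt (by norm_num)]
      norm_num
    obtain ⟨a, ha, hh, h0⟩ := exists_height_eq_of_mem_markovSpectrum hM h3 h13
    -- Stated for an arbitrary sequence because it is applied to a or to its reversal, whichever is
    -- obstructed on the right.
    have key : ∀ a : ℤ → ℕ+, (∀ i, a i = 1 ∨ a i = 2) → (∀ i, height a i ≤ m) →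
        height a 0 = m → ¬ RightExtendable a m → m ∈ contFracCantor {1, 2} +
          ⋃ d : ℕ × ℕ × ℤ × List ℕ+,
            (fun x => 2 + x) '' (cf '' obstructedTails d.1 d.2.1 d.2.2.1 d.2.2.2) := by
      intro a ha hh h0 hex
      have h2 : a 0 = 2 := (ha 0).resolve_left fun h1 => by
        have := height_lt_sqrt_ten ha (Or.inl h1)
        linarith
      obtain ⟨N, j, z, u, hmem⟩ := exists_obstructedTails ha h2 hh h10 hex
      refine ⟨cf (leftTail a 0), cf_mem_contFracCantor fun k => ha _, 2 + cf (rightTail a 0),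
        Set.mem_iUnion.2 ⟨(N, j, z, u), _, ⟨_, hmem, rfl⟩, rfl⟩, ?_⟩
      rw [← h0, height, h2]
      push_cast
      ring
    by_cases hex : RightExtendable a m
    · refine key (rev a) (fun i => ha _) (fun i => by rw [height_rev]; exact hh _)
        (by rw [height_rev]; exact h0) fun hex' => hL ?_
      exact mem_lagrangeSpectrum_of_extendable ha (by linarith) h0 hex hex'
    · exact key a ha hh h0 hex
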